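/- For $f:\{0,1\}^n\to\{0,1\}$ and $x\in\{0,1\}^n$, a certificate for $f$'s value at $x$ is a set $S\subseteq[n]$ such that $f(y)=f(x)$ for every $y\in\{0,1\}^n$ that agrees with $x$ on $S$. Let $\mathrm{Cert}(f,x)$ be the size of a smallest certificate for $f$'s value at $x$, and $\mathrm{Cert}(f)=\max_{x\in\{0,1\}^n}\mathrm{Cert}(f,x)$. There is a randomized algorithm with access to an oracle for a language in $\mathsf{NP}$, a polynomial $p$, an absolute constant $K$, and a function $\varepsilon:\mathbb N\to\mathbb R$ with $\varepsilon(n)\le n^{-\omega(1)}$ such that the following holds for every $n$, every Boolean circuit computing a function $f:\{0,1\}^n\to\{0,1\}$ with $s$ gates, and every $x^\star\in\{0,1\}^n$. Given only the circuit and $x^\star$ (in particular, not the value $\mathrm{Cert}(f)$), the algorithm halts within $p(n+s)$ steps for every outcome of its coin tosses (hence in time $\mathrm{poly}(n)$ on circuits of size $\mathrm{poly}(n)$), and with probability at least $1-\varepsilon(n)$ it outputs a certificate $S\subseteq[n]$ for $f$'s value at $x^\star$ with $|S|\le K\cdot\mathrm{Cert}(f)^5$. -/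

import Mathlib

/-! ### Machine model: randomized oracle machines working on finitely many stacks of bits -/

/-- Programs of a multi-stack machine over the alphabet `{0,1}`. A program mentions only finitely
many of the stacks, which are numbered by `ℕ`. Each instruction looks at, removes or adds a single
bit on top of a stack, so one step is one step of a multi-tape Turing machine (a stack is a one-sided
tape, two stacks form a two-sided one); `flip` tosses a fair coin, and `query` is the usual oracle
call, answered in one step. -/
inductive Prog : Type
  | skip : Prog
  /-- push the bit `b` on stack `r` -/
  | push (r : ℕ) (b : Bool) : Prog
  /-- remove the top bit of stack `r` (no effect on an empty stack) -/
  | pop (r : ℕ) : Prog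
  /-- push a fair random bit on stack `r` -/
  | flip (r : ℕ) : Prog
  /-- ask whether the content of stack `q` belongs to the oracle; push the answer on stack `a` -/
  | query (q a : ℕ) : Prog
  | seq (P Q : Prog) : Prog
  /-- continue with `E`, `P₀`, `P₁` if stack `r` is empty, has top bit `0`, has top bit `1` -/
  | branch (r : ℕ) (E P₀ P₁ : Prog) : Prog
  /-- repeat `P` as long as stack `r` is nonempty -/
  | loop (r : ℕ) (P : Prog) : Prog

/-- No coin tosses and no oracle calls. -/
def Prog.IsDeterministic : Prog → Prop
  | .skip => True
  | .push _ _ => True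
  | .pop _ => True
  | .flip _ => False
  | .query _ _ => False
  | .seq P Q => P.IsDeterministic ∧ Q.IsDeterministic
  | .branch _ E P₀ P₁ => E.IsDeterministic ∧ P₀.IsDeterministic ∧ P₁.IsDeterministic
  | .loop _ P => P.IsDeterministic

/-- Contents of the stacks; the head of the list is the top of the stack. -/
abbrev Store : Type := ℕ → List Bool

/-- A configuration: what remains to be executed (the program counter), and the stacks. -/
structure Config : Type where
  todo : List Prog
  store : Store

/-- One step of the machine with oracle `O`, where `c` is the coin of this step (it matters only if
the instruction is `flip`). A configuration with nothing left to execute has halted and stays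
as it is. -/
noncomputable def step (O : Language Bool) (c : Bool) : Config → Config
  | ⟨[], σ⟩ => ⟨[], σ⟩
  | ⟨.skip :: k, σ⟩ => ⟨k, σ⟩
  | ⟨.push r b :: k, σ⟩ => ⟨k, Function.update σ r (b :: σ r)⟩
  | ⟨.pop r :: k, σ⟩ => ⟨k, Function.update σ r (σ r).tail⟩
  | ⟨.flip r :: k, σ⟩ => ⟨k, Function.update σ r (c :: σ r)⟩
  | ⟨.query q a :: k, σ⟩ =>
      ⟨k, Function.update σ a (@decide (σ q ∈ O) (Classical.propDecidable _) :: σ a)⟩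
  | ⟨.seq P Q :: k, σ⟩ => ⟨P :: Q :: k, σ⟩
  | ⟨.branch r E P₀ P₁ :: k, σ⟩ =>
      match σ r with
      | [] => ⟨E :: k, σ⟩
      | false :: _ => ⟨P₀ :: k, σ⟩
      | true :: _ => ⟨P₁ :: k, σ⟩
  | ⟨.loop r P :: k, σ⟩ =>
      match σ r with
      | [] => ⟨k, σ⟩
      | _ :: _ => ⟨P :: .loop r P :: k, σ⟩

/-- The configuration reached after `coins.length` steps, with the given coins. -/
noncomputable def run (O : Language Bool) (P : Prog) (σ : Store) (coins : List Bool) : Config :=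
  coins.foldl (fun γ c => step O c γ) ⟨[P], σ⟩

/-- The initial stacks on a pair of input strings: stack `0` holds the first one, stack `1` the
second one, and all other stacks are empty. -/
def inputStore (u v : List Bool) : Store
  | 0 => u
  | 1 => v
  | _ + 2 => []

/-- On input `(u, v)` the program halts within `T` steps, whatever the coins are. -/
def HaltsWithin (O : Language Bool) (P : Prog) (u v : List Bool) (T : ℕ) : Prop :=
  ∀ coins : List Bool, coins.length = T → (run O P (inputStore u v) coins).todo = []

/-- The probability, over `T` independent fair coins, that on input `(u, v)` the program has halted
after `T` steps with an output in `A`. The output is the content of stack `0`. -/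
noncomputable def outputProb (O : Language Bool) (P : Prog) (u v : List Bool) (T : ℕ)
    (A : Set (List Bool)) : ℝ :=
  (Nat.card {r : Fin T → Bool // (run O P (inputStore u v) (List.ofFn r)).todo = [] ∧
    (run O P (inputStore u v) (List.ofFn r)).store 0 ∈ A} : ℝ) / 2 ^ T

/-- The class NP: membership has witnesses of polynomial length that are checked by a deterministic
polynomial-time program (without oracle). The program accepts by halting with output `1`. -/
def InNP (L : Language Bool) : Prop :=
  ∃ (V : Prog) (p q : Polynomial ℕ), V.IsDeterministic ∧
    (∀ x w : List Bool, HaltsWithin 0 V x w (p.eval (x.length + w.length))) ∧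
    ∀ x : List Bool, x ∈ L ↔ ∃ w : List Bool, w.length ≤ q.eval x.length ∧
      (run 0 V (inputStore x w)
        (List.replicate (p.eval (x.length + w.length)) false)).store 0 = [true]

/-! ### Boolean circuits -/

/-- Gates; the arguments are numbers of wires. -/
inductive Gate : Type
  | const (b : Bool) : Gate
  | not (i : ℕ) : Gate
  | and (i j : ℕ) : Gate
  | or (i j : ℕ) : Gate

/-- All arguments of the gate are among the wires `0, …, m - 1`. -/
def Gate.ArgsLt (m : ℕ) : Gate → Prop
  | .const _ => True
  | .not i => i < m
  | .and i j => i < m ∧ j < m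
  | .or i j => i < m ∧ j < m

def Gate.eval (wires : List Bool) : Gate → Bool
  | .const b => b
  | .not i => !(wires.getD i false)
  | .and i j => wires.getD i false && wires.getD j false
  | .or i j => wires.getD i false || wires.getD j false

/-- Boolean circuits with `n` inputs. Wires `0, …, n - 1` are the inputs, wire `n + k` is the output
of the `k`-th gate, and gates read earlier wires only. -/
structure Circuit (n : ℕ) : Type where
  gates : List Gate
  out : ℕ
  argsLt : ∀ (k : ℕ) (hk : k < gates.length), gates[k].ArgsLt (n + k)
  outLt : out < n + gates.length

namespace Circuit

def size {n : ℕ} (C : Circuit n) : ℕ := C.gates.length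

/-- The Boolean function computed by the circuit. -/
def eval {n : ℕ} (C : Circuit n) (x : Fin n → Bool) : Bool :=
  (C.gates.foldl (fun wires g => wires ++ [g.eval wires]) (List.ofFn x)).getD C.out false

end Circuit

/-! ### Encoding by bit strings -/

/-- `1ᵏ0` -/
def encodeNat (k : ℕ) : List Bool := List.replicate k true ++ [false]

def Gate.encode : Gate → List Bool
  | .const b => [false, false, b]
  | .not i => [false, true] ++ encodeNat i
  | .and i j => [true, false] ++ encodeNat i ++ encodeNat j
  | .or i j => [true, true] ++ encodeNat i ++ encodeNat j

/-- The number of inputs, the gates (each announced by a `1`, the end of the list by a `0`), and the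
output wire. The length is polynomial in `n + C.size`, since wire numbers are below `n + C.size`. -/
def Circuit.encode {n : ℕ} (C : Circuit n) : List Bool :=
  encodeNat n ++ C.gates.flatMap (fun g => true :: g.encode) ++ [false] ++ encodeNat C.out

/-- A set of coordinates as its characteristic string. -/
def encodeSet {n : ℕ} (S : Finset (Fin n)) : List Bool :=
  List.ofFn fun i => decide (i ∈ S)

/-! ### Certificates -/

/-- `S` is a certificate for the value of `f` at `x`. -/
def IsCertificate {n : ℕ} (f : (Fin n → Bool) → Bool) (x : Fin n → Bool) (S : Finset (Fin n)) :
    Prop :=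
  ∀ y : Fin n → Bool, (∀ i ∈ S, y i = x i) → f x = f y

/-- The size of a smallest certificate for the value of `f` at `x`. -/
noncomputable def certAt {n : ℕ} (f : (Fin n → Bool) → Bool) (x : Fin n → Bool) : ℕ :=
  sInf {k | ∃ S : Finset (Fin n), IsCertificate f x S ∧ S.card = k}

/-- The certificate complexity of `f`. -/
noncomputable def certComplexity {n : ℕ} (f : (Fin n → Bool) → Bool) : ℕ :=
  Finset.univ.sup (certAt f)

/-!
Let `A` be maximal among the sets that are not certificates for `f` at `x`, and let `y` agree with
`x` on `A` while `f y ≠ f x`. By maximality, resetting a single coordinate of `y` outside `A` to its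
value in `x` changes the value of `f`, so every certificate for `y` contains `Aᶜ`, and `Aᶜ` has at
most `Cert(f)` elements. On the other hand `Aᶜ` meets every certificate for `x`. Starting from
`U = ∅`, extend `U` to a maximal non-certificate `A` and add `Aᶜ` to `U`, until `U` is a
certificate. The blocks `Aᶜ` are disjoint and each of them contains an element of a fixed
certificate for `x` of size at most `Cert(f)`, so the result has at most `Cert(f) ^ 2` elements.

A set is a non-certificate if `f` attains the value `!f x` on a subcube, which is a question in NP,
and `A` is found greedily, by one such question per coordinate. No coins are needed, and neither is
`f x`: for the value `f x` instead of `!f x` the same procedure adds nothing to `U`.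
-/

namespace Certification

open Function

/-! ### Maximal non-certificates -/

section Certificates

variable {n : ℕ} {f : (Fin n → Bool) → Bool} {x : Fin n → Bool} {b : Bool}
  {A B S U : Finset (Fin n)}

theorem isCertificate_mono (h : IsCertificate f x A) (hAB : A ⊆ B) : IsCertificate f x B :=
  fun y hy => h y fun i hi => hy i (hAB hi)

theorem isCertificate_univ (f : (Fin n → Bool) → Bool) (x : Fin n → Bool) :
    IsCertificate f x Finset.univ :=
  fun y hy => by rw [funext fun i => hy i (Finset.mem_univ i)]

theorem certAt_le_certComplexity (f : (Fin n → Bool) → Bool) (x : Fin n → Bool) :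
    certAt f x ≤ certComplexity f :=
  Finset.le_sup (Finset.mem_univ x)

theorem exists_isCertificate_card_eq_certAt (f : (Fin n → Bool) → Bool) (x : Fin n → Bool) :
    ∃ S, IsCertificate f x S ∧ S.card = certAt f x :=
  Nat.sInf_mem (s := {k | ∃ S, IsCertificate f x S ∧ S.card = k})
    ⟨_, Finset.univ, isCertificate_univ f x, rfl⟩

/-- `f` attains the value `b` on the subcube of the points that agree with `x` on `A`. -/
def Attains (f : (Fin n → Bool) → Bool) (x : Fin n → Bool) (b : Bool) (A : Finset (Fin n)) : Prop :=
  ∃ y : Fin n → Bool, (∀ i ∈ A, y i = x i) ∧ f y = b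

theorem Attains.anti (h : Attains f x b B) (hAB : A ⊆ B) : Attains f x b A := by
  obtain ⟨y, hy, hb⟩ := h
  exact ⟨y, fun i hi => hy i (hAB hi), hb⟩

theorem attains_self (A : Finset (Fin n)) : Attains f x (f x) A := ⟨x, fun _ _ => rfl, rfl⟩

theorem attains_not_iff : Attains f x (!f x) A ↔ ¬ IsCertificate f x A := by
  simp [Attains, IsCertificate, Bool.eq_not, eq_comm]

/-- Let `y` agree with `x` on `A` and `f y ≠ f x`. By maximality of `A`, resetting any coordinate
`i ∉ A` of `y` to `x i` changes the value back, so every certificate for `y` contains `i`. -/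
theorem card_compl_le_certComplexity (hA : Maximal (Attains f x (!f x)) A) :
    Aᶜ.card ≤ certComplexity f := by
  obtain ⟨y, hyx, hfy⟩ := hA.prop
  obtain ⟨S, hS, hcard⟩ := exists_isCertificate_card_eq_certAt f y
  have hsub : Aᶜ ⊆ S := by
    intro i hi
    by_contra hiS
    have hagree : ∀ j ∈ S, Function.update y i (x i) j = y j := fun j hj =>
      update_of_ne (ne_of_mem_of_not_mem hj hiS) _ _
    have hattains : Attains f x (!f x) (insert i A) := by
      refine ⟨Function.update y i (x i), fun j hj => ?_, (hS _ hagree).symm.trans hfy⟩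
      rcases eq_or_ne j i with rfl | hji
      · exact update_self ..
      · rw [update_of_ne hji, hyx j (Finset.mem_of_mem_insert_of_ne hj hji)]
    exact Finset.mem_compl.1 hi (hA.le_of_ge hattains (Finset.subset_insert i A)
      (Finset.mem_insert_self i A))
  calc Aᶜ.card ≤ S.card := Finset.card_le_card hsub
    _ = certAt f y := hcard
    _ ≤ certComplexity f := certAt_le_certComplexity f y

theorem compl_inter_nonempty (hA : Attains f x (!f x) A) (hS : IsCertificate f x S) :
    (Aᶜ ∩ S).Nonempty := by
  obtain ⟨i, hiS, hiA⟩ := Finset.not_subset.1 fun hSA =>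
    attains_not_iff.1 hA (isCertificate_mono hS hSA)
  exact ⟨i, by simp [hiA, hiS]⟩

/-! ### The greedy construction -/

/-- The marked set `U`, where the marks of the first coordinates are overridden by those in `a`. -/
def overrideSet (U : Finset (Fin n)) (a : List Bool) : Finset (Fin n) :=
  {i | a.getD i (decide (i ∈ U)) = true}

open Classical in
/-- The result of `t` binary decisions, each of which is positive if that is compatible with the
property `q`. -/
noncomputable def greedyBits (q : List Bool → Prop) : ℕ → List Bool
  | 0 => []
  | t + 1 => greedyBits q t ++ [decide (q (greedyBits q t ++ [true]))]

/-- The set obtained from `U` by adding, in their order, the coordinates that can be added without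
violating `p`. -/
noncomputable def greedySet (p : Finset (Fin n) → Prop) (U : Finset (Fin n)) : Finset (Fin n) :=
  overrideSet U (greedyBits (fun a => p (overrideSet U a)) n)

theorem length_greedyBits (q : List Bool → Prop) (t : ℕ) : (greedyBits q t).length = t := by
  induction t with
  | zero => rfl
  | succ t ih => rw [greedyBits, List.length_append, ih, List.length_singleton]

theorem overrideSet_nil (U : Finset (Fin n)) : overrideSet U [] = U := by
  ext; simp [overrideSet]

theorem overrideSet_append_true (a : List Bool) (h : a.length < n) :
    overrideSet U (a ++ [true]) = insert ⟨a.length, h⟩ (overrideSet U a) := by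
  ext i
  grind [overrideSet]

theorem overrideSet_append_false (a : List Bool) (h : a.length < n) :
    overrideSet U (a ++ [false]) = (overrideSet U a).erase ⟨a.length, h⟩ := by
  ext i
  grind [overrideSet]

theorem overrideSet_greedyBits {p : Finset (Fin n) → Prop} (hp : Antitone p) (hU : p U) {t : ℕ}
    (ht : t ≤ n) :
    let A := overrideSet U (greedyBits (fun a => p (overrideSet U a)) t)
    U ⊆ A ∧ p A ∧ ∀ i : Fin n, i < t → p (insert i A) → i ∈ A := by
  classical
  induction t with
  | zero => simpa [greedyBits, overrideSet_nil] using hU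
  | succ t ih =>
    obtain ⟨hUA, hA, hmax⟩ := ih (t.le_succ.trans ht)
    rw [greedyBits]
    set a := greedyBits (fun a => p (overrideSet U a)) t
    have ha : a.length = t := length_greedyBits _ t
    have hins := overrideSet_append_true (U := U) a (ha.trans_lt ht)
    set k : Fin n := ⟨a.length, ha.trans_lt ht⟩
    have hk : ∀ i : Fin n, i < t + 1 → i < t ∨ i = k := fun i hi =>
      (Nat.lt_succ_iff_lt_or_eq.1 hi).imp_right fun hit => Fin.ext (hit.trans ha.symm)
    by_cases hq : p (overrideSet U (a ++ [true]))
    · rw [decide_eq_true hq, hins]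
      rw [hins] at hq
      refine ⟨hUA.trans (Finset.subset_insert k _), hq, fun i hi h => ?_⟩
      rcases hk i hi with hit | rfl
      · exact Finset.mem_insert_of_mem <| hmax i hit <|
          hp (Finset.insert_subset_insert i (Finset.subset_insert k _)) h
      · exact Finset.mem_insert_self k _
    · rw [decide_eq_false hq]
      rw [hins] at hq
      have hkA : k ∉ overrideSet U a := fun hkA => hq (by rwa [Finset.insert_eq_of_mem hkA])
      rw [overrideSet_append_false a (ha.trans_lt ht), Finset.erase_eq_of_notMem hkA]
      refine ⟨hUA, hA, fun i hi h => ?_⟩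
      rcases hk i hi with hit | rfl
      · exact hmax i hit h
      · exact absurd h hq

theorem subset_greedySet {p : Finset (Fin n) → Prop} (hp : Antitone p) (hU : p U) :
    U ⊆ greedySet p U :=
  (overrideSet_greedyBits hp hU le_rfl).1

theorem maximal_greedySet {p : Finset (Fin n) → Prop} (hp : Antitone p) (hU : p U) :
    Maximal p (greedySet p U) := by
  obtain ⟨-, hA, hmax⟩ := overrideSet_greedyBits hp hU le_rfl
  exact ⟨hA, fun B hB hAB i hi => hmax i i.isLt (hp (Finset.insert_subset hi hAB) hB)⟩

/-! ### Collecting the complements -/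

open Classical in
/-- If `f` attains `b` on the subcube of `U`, add to `U` the complement of a maximal superset for
which it still does. For `b ≠ f x` this is a maximal non-certificate, for `b = f x` the whole of
`Fin n`. -/
noncomputable def nextSet (f : (Fin n → Bool) → Bool) (x : Fin n → Bool) (b : Bool)
    (U : Finset (Fin n)) : Finset (Fin n) :=
  if Attains f x b U then U ∪ (greedySet (Attains f x b) U)ᶜ else U

theorem antitone_attains : Antitone (Attains f x b) := fun _ _ hAB h => h.anti hAB

theorem nextSet_self : nextSet f x (f x) U = U := by
  have hmax := maximal_greedySet (U := U) antitone_attains (attains_self (f := f) (x := x) U)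
  have huniv : greedySet (Attains f x (f x)) U = Finset.univ :=
    hmax.eq_of_le (attains_self _) (Finset.subset_univ _)
  simp [nextSet, huniv]

theorem nextSet_of_isCertificate (hU : IsCertificate f x U) : nextSet f x b U = U := by
  rcases Bool.eq_or_eq_not b (f x) with rfl | rfl
  · exact nextSet_self
  · exact if_neg fun h => attains_not_iff.1 h hU

theorem card_lt_card_nextSet (hU : ¬ IsCertificate f x U) :
    U.card < (nextSet f x (!f x) U).card := by
  have h := attains_not_iff.2 hU
  have hA := (maximal_greedySet antitone_attains h).prop
  obtain ⟨i, hi⟩ : (greedySet (Attains f x (!f x)) U)ᶜ.Nonempty :=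
    (compl_inter_nonempty hA (isCertificate_univ f x)).mono Finset.inter_subset_left
  have hiU : i ∉ U := fun hiU => Finset.mem_compl.1 hi (subset_greedySet antitone_attains h hiU)
  rw [nextSet, if_pos h]
  exact Finset.card_lt_card <| Finset.ssubset_iff_subset_ne.2 ⟨Finset.subset_union_left,
    fun heq => hiU (heq ▸ Finset.mem_union_right U hi)⟩

/-- A block of at most `certComplexity f` elements is added only together with an element of the
certificate `S`. -/
theorem card_nextSet_le (hS : IsCertificate f x S)
    (hU : U.card ≤ certComplexity f * (U ∩ S).card) :
    (nextSet f x b U).card ≤ certComplexity f * (nextSet f x b U ∩ S).card := by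
  rcases Bool.eq_or_eq_not b (f x) with rfl | rfl
  · rwa [nextSet_self]
  rw [nextSet]
  split_ifs with h
  · set A := greedySet (Attains f x (!f x)) U
    have hA : Maximal (Attains f x (!f x)) A := maximal_greedySet antitone_attains h
    have hdisj : Disjoint U Aᶜ :=
      disjoint_compl_right.mono_left (subset_greedySet antitone_attains h)
    calc (U ∪ Aᶜ).card = U.card + Aᶜ.card := Finset.card_union_of_disjoint hdisj
      _ ≤ certComplexity f * (U ∩ S).card + certComplexity f * 1 :=
        add_le_add hU (by rw [mul_one]; exact card_compl_le_certComplexity hA)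
      _ ≤ certComplexity f * (U ∩ S).card + certComplexity f * (Aᶜ ∩ S).card := by
        gcongr
        exact (compl_inter_nonempty hA.prop hS).card_pos
      _ = certComplexity f * ((U ∪ Aᶜ) ∩ S).card := by
        rw [← mul_add, Finset.union_inter_distrib_right, Finset.card_union_of_disjoint
          (hdisj.mono Finset.inter_subset_left Finset.inter_subset_left)]
  · exact hU

/-- The set obtained from `∅` in `t` rounds. -/
noncomputable def certSet (f : (Fin n → Bool) → Bool) (x : Fin n → Bool) (t : ℕ) :
    Finset (Fin n) :=
  (nextSet f x false ∘ nextSet f x true)^[t] ∅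

theorem nextSet_false_nextSet_true :
    nextSet f x false (nextSet f x true U) = nextSet f x (!f x) U := by
  cases h : f x
  · rw [← h, nextSet_self, h, Bool.not_false]
  · rw [← h, nextSet_self, h, Bool.not_true]

theorem certSet_succ (f : (Fin n → Bool) → Bool) (x : Fin n → Bool) (t : ℕ) :
    certSet f x (t + 1) = nextSet f x (!f x) (certSet f x t) := by
  rw [certSet, Function.iterate_succ_apply', Function.comp_apply, nextSet_false_nextSet_true,
    certSet]

theorem isCertificate_certSet_or_le_card (t : ℕ) :
    IsCertificate f x (certSet f x t) ∨ t ≤ (certSet f x t).card := by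
  induction t with
  | zero => exact .inr (Nat.zero_le _)
  | succ t ih =>
    rw [certSet_succ]
    by_cases hcert : IsCertificate f x (certSet f x t)
    · exact .inl (by rwa [nextSet_of_isCertificate hcert])
    · exact .inr ((ih.resolve_left hcert).trans_lt (card_lt_card_nextSet hcert))

theorem isCertificate_certSet (f : (Fin n → Bool) → Bool) (x : Fin n → Bool) :
    IsCertificate f x (certSet f x n) := by
  refine (isCertificate_certSet_or_le_card n).elim id fun hcard => ?_
  have huniv : certSet f x n = Finset.univ := by
    rw [← Finset.card_eq_iff_eq_univ, Fintype.card_fin]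
    exact (card_finset_fin_le _).antisymm hcard
  exact huniv ▸ isCertificate_univ f x

theorem card_certSet_le (f : (Fin n → Bool) → Bool) (x : Fin n → Bool) (t : ℕ) :
    (certSet f x t).card ≤ certComplexity f ^ 2 := by
  obtain ⟨S, hS, hcard⟩ := exists_isCertificate_card_eq_certAt f x
  have hblocks : (certSet f x t).card ≤ certComplexity f * (certSet f x t ∩ S).card := by
    induction t with
    | zero => simp [certSet]
    | succ t ih => exact certSet_succ f x t ▸ card_nextSet_le hS ih
  calc (certSet f x t).card ≤ certComplexity f * (certSet f x t ∩ S).card := hblocks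
    _ ≤ certComplexity f * certComplexity f := by
      gcongr
      exact (Finset.card_le_card Finset.inter_subset_right).trans
        (hcard.trans_le (certAt_le_certComplexity f x))
    _ = certComplexity f ^ 2 := (sq _).symm

end Certificates

/-! ### Effect and running time of coin-free programs -/

open Classical in
/-- Iterate `F` until stack `r` is empty. If this never happens, the value is the empty store. -/
noncomputable def whileNonempty (r : ℕ) (F : Store → Store) (σ : Store) : Store :=
  if h : ∃ m, (F^[m] σ) r = [] then F^[Nat.find h] σ else fun _ => []

theorem whileNonempty_of_eq_nil {r : ℕ} {F : Store → Store} {σ : Store} (h : σ r = []) :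
    whileNonempty r F σ = σ := by
  classical
  have hex : ∃ m, (F^[m] σ) r = [] := ⟨0, h⟩
  have h0 : Nat.find hex = 0 := (Nat.find_eq_zero hex).2 h
  rw [whileNonempty, dif_pos hex, h0, iterate_zero, id]

theorem whileNonempty_of_ne_nil {r : ℕ} {F : Store → Store} {σ : Store} (h : σ r ≠ []) :
    whileNonempty r F σ = whileNonempty r F (F σ) := by
  classical
  by_cases hex : ∃ m, (F^[m] (F σ)) r = []
  · have hex' : ∃ m, (F^[m] σ) r = [] := hex.imp' Nat.succ fun _ hm => hm
    have hfind : Nat.find hex' = Nat.find hex + 1 := Nat.find_comp_succ hex' hex h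
    rw [whileNonempty, whileNonempty, dif_pos hex, dif_pos hex', hfind, iterate_succ_apply]
  · have hex' : ¬ ∃ m, (F^[m] σ) r = [] := by
      rintro ⟨_ | m, hm⟩
      · exact h hm
      · exact hex ⟨m, hm⟩
    rw [whileNonempty, whileNonempty, dif_neg hex, dif_neg hex']

open Classical in
/-- The denotation of a program: its effect on the stacks, provided that it halts and tosses no
coins. The values for `flip` and for a loop that does not end are junk. -/
noncomputable def den (O : Language Bool) : Prog → Store → Store
  | .skip, σ => σ
  | .push r b, σ => update σ r (b :: σ r)
  | .pop r, σ => update σ r (σ r).tail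
  | .flip _, σ => σ
  | .query q a, σ => update σ a (decide (σ q ∈ O) :: σ a)
  | .seq P Q, σ => den O Q (den O P σ)
  | .branch r E P₀ P₁, σ =>
      match σ r with
      | [] => den O E σ
      | false :: _ => den O P₀ σ
      | true :: _ => den O P₁ σ
  | .loop r P, σ => whileNonempty r (den O P) σ

/-- From `σ` the program `P` comes to its end after exactly `t` steps, with stacks `σ'`, whatever
the coins are and whatever remains to be executed afterwards. -/
def Exec (O : Language Bool) (P : Prog) (σ σ' : Store) (t : ℕ) : Prop :=
  ∀ (k : List Prog) (coins : List Bool), coins.length = t →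
    coins.foldl (fun γ c => step O c γ) ⟨P :: k, σ⟩ = ⟨k, σ'⟩

variable {O : Language Bool} {P Q R : Prog} {σ σ' σ₁ σ₂ : Store} {r : ℕ} {t t₁ t₂ : ℕ}

theorem den_loop_of_eq_nil (h : σ r = []) : den O (.loop r P) σ = σ :=
  whileNonempty_of_eq_nil h

theorem den_loop_of_ne_nil (h : σ r ≠ []) : den O (.loop r P) σ = den O (.loop r P) (den O P σ) :=
  whileNonempty_of_ne_nil h

theorem Exec.of_step (h : ∀ k c, step O c ⟨P :: k, σ⟩ = ⟨k, σ'⟩) : Exec O P σ σ' 1 := by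
  intro k coins hc
  obtain ⟨c, rfl⟩ := List.length_eq_one_iff.1 hc
  exact h k c

theorem Exec.cons_step (h : ∀ k c, step O c ⟨P :: k, σ⟩ = ⟨Q :: k, σ⟩) (hQ : Exec O Q σ σ' t) :
    Exec O P σ σ' (t + 1) := by
  intro k coins hc
  obtain ⟨c, coins, rfl⟩ := List.exists_cons_of_length_eq_add_one hc
  rw [List.foldl_cons, h]
  exact hQ k coins (by simpa using hc)

theorem Exec.cons_step₂ (h : ∀ k c, step O c ⟨P :: k, σ⟩ = ⟨Q :: R :: k, σ⟩)
    (hQ : Exec O Q σ σ₁ t₁) (hR : Exec O R σ₁ σ₂ t₂) : Exec O P σ σ₂ (t₁ + t₂ + 1) := by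
  intro k coins hc
  obtain ⟨c, coins, rfl⟩ := List.exists_cons_of_length_eq_add_one hc
  have hl : coins.length = t₁ + t₂ := by simpa using hc
  rw [List.foldl_cons, h, ← List.take_append_drop t₁ coins, List.foldl_append,
    hQ _ _ (by simp [hl]), hR _ _ (by simp [hl])]

theorem Exec.seq (hP : Exec O P σ σ₁ t₁) (hQ : Exec O Q σ₁ σ₂ t₂) :
    Exec O (.seq P Q) σ σ₂ (t₁ + t₂ + 1) :=
  .cons_step₂ (fun _ _ => rfl) hP hQ

theorem Exec.loop_nil (h : σ r = []) : Exec O (.loop r P) σ σ 1 :=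
  .of_step fun _ _ => by simp only [step, h]

theorem Exec.loop_cons (h : σ r ≠ []) (hP : Exec O P σ σ₁ t₁)
    (hL : Exec O (.loop r P) σ₁ σ₂ t₂) : Exec O (.loop r P) σ σ₂ (t₁ + t₂ + 1) := by
  obtain ⟨b, l, h⟩ := List.exists_cons_of_ne_nil h
  exact .cons_step₂ (fun _ _ => by simp only [step, h]) hP hL

/-- A loop whose stack `r` serves as a counter for the iterations of its body. -/
theorem Exec.iterate {α : Type*} (s : ℕ → α → Store) (next : α → α) {T : ℕ}
    (hr : ∀ k a, s k a r = List.replicate k true)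
    (k : ℕ) (hP : ∀ j < k, ∀ a, ∃ t ≤ T, Exec O P (s (j + 1) a) (s j (next a)) t) (a : α) :
    ∃ t ≤ k * (T + 1) + 1, Exec O (.loop r P) (s k a) (s 0 (next^[k] a)) t := by
  induction k generalizing a with
  | zero => exact ⟨1, by lia, .loop_nil (hr 0 a)⟩
  | succ k ih =>
    obtain ⟨t, ht, hbody⟩ := hP k k.lt_succ_self a
    obtain ⟨t', ht', hrest⟩ := ih (fun j hj => hP j (hj.trans k.lt_succ_self)) (next a)
    exact ⟨t + t' + 1, by linarith, .loop_cons (by simp [hr]) hbody hrest⟩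

theorem foldl_step_of_halted (σ : Store) (coins : List Bool) :
    coins.foldl (fun γ c => step O c γ) ⟨[], σ⟩ = ⟨[], σ⟩ := by
  induction coins with
  | nil => rfl
  | cons _ _ ih => exact ih

theorem Exec.run_eq (h : Exec O P σ σ' t) {coins : List Bool} (hc : t ≤ coins.length) :
    run O P σ coins = ⟨[], σ'⟩ := by
  rw [run, ← List.take_append_drop t coins, List.foldl_append, h [] _ (by simpa using hc),
    foldl_step_of_halted]

/-! ### Space bounds -/

/-- The number of bits on the stacks in `s`. -/
def size (s : Finset ℕ) (σ : Store) : ℕ := ∑ r ∈ s, (σ r).length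

/-- All stacks together hold at most `m` bits. -/
def SizeLE (σ : Store) (m : ℕ) : Prop := ∀ s, size s σ ≤ m

theorem size_update_of_mem {s : Finset ℕ} (hr : r ∈ s) (σ : Store) (l : List Bool) :
    size s (update σ r l) + (σ r).length = size s σ + l.length := by
  have h := Finset.add_sum_erase s (fun i => (σ i).length) hr
  have h' := Finset.add_sum_erase s (fun i => (update σ r l i).length) hr
  have hrest : ∑ i ∈ s.erase r, (update σ r l i).length = ∑ i ∈ s.erase r, (σ i).length :=
    Finset.sum_congr rfl fun i hi => by rw [update_of_ne (Finset.ne_of_mem_erase hi)]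
  simp only [update_self] at h'
  unfold size
  lia

theorem SizeLE.mono {m m' : ℕ} (h : SizeLE σ m) (hm : m ≤ m') : SizeLE σ m' :=
  fun s => (h s).trans hm

theorem SizeLE.update {m m' : ℕ} {l : List Bool} (h : SizeLE σ m)
    (hl : m + l.length ≤ m' + (σ r).length) : SizeLE (Function.update σ r l) m' := by
  intro s
  have hsub : size s (Function.update σ r l) ≤ size (insert r s) (Function.update σ r l) :=
    Finset.sum_le_sum_of_subset (Finset.subset_insert r s)
  have := size_update_of_mem (Finset.mem_insert_self r s) σ l
  have := h (insert r s)
  lia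

theorem SizeLE.update_add {m : ℕ} (h : SizeLE σ m) (r : ℕ) (l : List Bool) :
    SizeLE (Function.update σ r l) (m + l.length) :=
  h.update (Nat.le_add_right _ _)

theorem sizeLE_nil : SizeLE (fun _ => []) 0 := fun s => by simp [size]

/-- The stacks on which a program may push a bit. -/
def pushes : Prog → Finset ℕ
  | .skip => ∅
  | .push r _ => {r}
  | .pop _ => ∅
  | .flip r => {r}
  | .query _ a => {a}
  | .seq P Q => pushes P ∪ pushes Q
  | .branch _ E P₀ P₁ => pushes E ∪ pushes P₀ ∪ pushes P₁
  | .loop _ P => pushes P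

theorem length_iterate_le {F : Store → Store} (hF : ∀ σ, (F σ r).length ≤ (σ r).length) (m : ℕ)
    (σ : Store) : (F^[m] σ r).length ≤ (σ r).length := by
  induction m generalizing σ with
  | zero => rfl
  | succ m ih => exact (ih (F σ)).trans (hF σ)

theorem length_den_le : ∀ {P : Prog}, r ∉ pushes P → ∀ σ : Store,
    (den O P σ r).length ≤ (σ r).length
  | .skip, _, _ => le_rfl
  | .push s b, h, σ => by
      rw [den, update_of_ne (by simpa [pushes] using h)]
  | .pop s, _, σ => by
      rcases eq_or_ne r s with rfl | hs
      · simp [den]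
      · rw [den, update_of_ne hs]
  | .flip _, _, _ => le_rfl
  | .query q a, h, σ => by
      rw [den, update_of_ne (by simpa [pushes] using h)]
  | .seq P Q, h, σ => by
      rw [pushes, Finset.notMem_union] at h
      exact (length_den_le h.2 _).trans (length_den_le h.1 σ)
  | .branch s E P₀ P₁, h, σ => by
      simp only [pushes, Finset.notMem_union] at h
      rcases hs : σ s with _ | ⟨_ | _, l⟩
      · simpa only [den, hs] using length_den_le h.1.1 σ
      · simpa only [den, hs] using length_den_le h.1.2 σ
      · simpa only [den, hs] using length_den_le h.2 σ
  | .loop s P, h, σ => by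
      rw [den, whileNonempty]
      split_ifs
      · exact length_iterate_le (length_den_le (P := P) h) _ σ
      · simp

theorem size_den_le {s : Finset ℕ} (h : Disjoint s (pushes P)) (σ : Store) :
    size s (den O P σ) ≤ size s σ :=
  Finset.sum_le_sum fun _ hr => length_den_le (Finset.disjoint_left.1 h hr) σ

/-! ### Running time and space -/

/-- On stacks holding at most `m` bits the program `P` comes to its end within `T m` steps, and the
stacks then hold at most `G m` bits. -/
def RunsIn (O : Language Bool) (P : Prog) (T G : ℕ → ℕ) : Prop :=
  ∀ σ m, SizeLE σ m → SizeLE (den O P σ) (G m) ∧ ∃ t ≤ T m, Exec O P σ (den O P σ) t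

section RunsIn

variable {T G T' G' : ℕ → ℕ} {g : ℕ}

theorem RunsIn.mono (h : RunsIn O P T G) (hT : ∀ m, T m ≤ T' m) (hG : ∀ m, G m ≤ G' m) :
    RunsIn O P T' G' := by
  intro σ m hσ
  obtain ⟨hsize, t, ht, hexec⟩ := h σ m hσ
  exact ⟨hsize.mono (hG m), t, ht.trans (hT m), hexec⟩

theorem runsIn_skip : RunsIn O .skip (fun _ => 1) (· + 0) :=
  fun _ _ hσ => ⟨hσ, 1, le_rfl, .of_step fun _ _ => rfl⟩

theorem runsIn_push (r : ℕ) (b : Bool) : RunsIn O (.push r b) (fun _ => 1) (· + 1) :=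
  fun _ _ hσ => ⟨hσ.update (by simp [add_right_comm, add_assoc]), 1, le_rfl,
    .of_step fun _ _ => rfl⟩

theorem runsIn_pop (r : ℕ) : RunsIn O (.pop r) (fun _ => 1) (· + 0) :=
  fun _ _ hσ => ⟨hσ.update (by simp), 1, le_rfl, .of_step fun _ _ => rfl⟩

theorem runsIn_query (q a : ℕ) : RunsIn O (.query q a) (fun _ => 1) (· + 1) :=
  fun _ _ hσ => ⟨hσ.update (by simp [add_right_comm, add_assoc]), 1, le_rfl,
    .of_step fun _ _ => rfl⟩

theorem RunsIn.seq (hP : RunsIn O P T G) (hQ : RunsIn O Q T' G') :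
    RunsIn O (.seq P Q) (fun m => T m + T' (G m) + 1) (fun m => G' (G m)) := by
  intro σ m hσ
  obtain ⟨hsize, t, ht, hexec⟩ := hP σ m hσ
  obtain ⟨hsize', t', ht', hexec'⟩ := hQ _ _ hsize
  exact ⟨hsize', _, by lia, hexec.seq hexec'⟩

/-- The measure `size s` strictly decreases with each iteration, so there are at most `m`. -/
theorem RunsIn.loop (hP : RunsIn O P T (· + g)) (s : Finset ℕ)
    (hdec : ∀ σ, σ r ≠ [] → size s (den O P σ) < size s σ) :
    RunsIn O (.loop r P) (fun m => m * (T (m + g * m) + 1) + 1) (fun m => m + g * m) := by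
  have key : ∀ M j m σ, size s σ ≤ j → SizeLE σ m → m + g * j ≤ M →
      SizeLE (den O (.loop r P) σ) (m + g * j) ∧
        ∃ t ≤ j * (T M + 1) + 1, Exec O (.loop r P) σ (den O (.loop r P) σ) t := by
    intro M j
    induction j with
    | zero =>
      intro m σ hj hσ _
      have hr : σ r = [] := by
        by_contra hr
        exact absurd (hdec σ hr) (by lia)
      rw [den_loop_of_eq_nil hr]
      exact ⟨hσ, 1, by lia, .loop_nil hr⟩
    | succ j ih =>
      intro m σ hj hσ hM
      by_cases hr : σ r = []
      · rw [den_loop_of_eq_nil hr]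
        exact ⟨hσ.mono (by lia), 1, by lia, .loop_nil hr⟩
      · rw [mul_add, mul_one] at hM
        obtain ⟨hrest, t', ht', hexec'⟩ := ih (m + g) (den O P σ)
          (by have := hdec σ hr; lia) (hP σ m hσ).1 (by lia)
        obtain ⟨-, t, ht, hexec⟩ := hP σ M (hσ.mono (by lia))
        rw [den_loop_of_ne_nil hr]
        exact ⟨hrest.mono (by lia), t + t' + 1, by lia, .loop_cons hr hexec hexec'⟩
  exact fun σ m hσ => key _ m m σ (hσ s) hσ le_rfl

end RunsIn

theorem monotone_eval (p : Polynomial ℕ) : Monotone fun m => p.eval m := by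
  induction p using Polynomial.induction_on' with
  | add p q hp hq => simpa only [Polynomial.eval_add] using hp.add hq
  | monomial k a =>
    intro m m' h
    simp only [Polynomial.eval_monomial]
    gcongr

theorem eval_apply_le_eval_add (p : Polynomial ℕ) (q : Bool → Polynomial ℕ) (b : Bool) (m : ℕ) :
    (q b).eval m ≤ (p + q false + q true).eval m := by
  cases b <;> simp only [Polynomial.eval_add] <;> lia

/-- `P` runs in polynomial time and leaves at most `g` more bits than it found. -/
def Tame (O : Language Bool) (P : Prog) (g : ℕ) : Prop :=
  ∃ T : Polynomial ℕ, RunsIn O P (fun m => T.eval m) (· + g)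

/-- `P` runs in time polynomial in the number of bits on the stacks. -/
def PolyTime (O : Language Bool) (P : Prog) : Prop :=
  ∃ T G : Polynomial ℕ, RunsIn O P (fun m => T.eval m) (fun m => G.eval m)

section Tame

variable {g g' : ℕ}

theorem Tame.polyTime (h : Tame O P g) : PolyTime O P := by
  obtain ⟨T, h⟩ := h
  exact ⟨T, .X + .C g, h.mono (fun _ => le_rfl) (by simp)⟩

theorem Tame.mono (h : Tame O P g) (hg : g ≤ g') : Tame O P g' := by
  obtain ⟨T, h⟩ := h
  exact ⟨T, h.mono (fun _ => le_rfl) (by simpa using hg)⟩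

theorem tame_skip : Tame O .skip 0 := ⟨1, by simpa using runsIn_skip⟩

theorem tame_push (r : ℕ) (b : Bool) : Tame O (.push r b) 1 := ⟨1, by simpa using runsIn_push r b⟩

theorem tame_pop (r : ℕ) : Tame O (.pop r) 0 := ⟨1, by simpa using runsIn_pop r⟩

theorem tame_query (q a : ℕ) : Tame O (.query q a) 1 := ⟨1, by simpa using runsIn_query q a⟩

theorem Tame.seq (hP : Tame O P g) (hQ : Tame O Q g') : Tame O (.seq P Q) (g + g') := by
  obtain ⟨T, hP⟩ := hP
  obtain ⟨T', hQ⟩ := hQ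
  exact ⟨T + T'.comp (.X + .C g) + 1, (hP.seq hQ).mono (by simp) (by simp [add_assoc])⟩

theorem PolyTime.seq (hP : PolyTime O P) (hQ : PolyTime O Q) : PolyTime O (.seq P Q) := by
  obtain ⟨T, G, hP⟩ := hP
  obtain ⟨T', G', hQ⟩ := hQ
  exact ⟨T + T'.comp G + 1, G'.comp G, (hP.seq hQ).mono (by simp) (by simp)⟩

theorem Tame.loop (hP : Tame O P 0) (s : Finset ℕ)
    (hdec : ∀ σ, σ r ≠ [] → size s (den O P σ) < size s σ) : Tame O (.loop r P) 0 := by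
  obtain ⟨T, hP⟩ := hP
  exact ⟨.X * (T + 1) + 1, (hP.loop s hdec).mono (by simp) (by simp)⟩

theorem Tame.polyTime_loop (hP : Tame O P g) (s : Finset ℕ)
    (hdec : ∀ σ, σ r ≠ [] → size s (den O P σ) < size s σ) : PolyTime O (.loop r P) := by
  obtain ⟨T, hP⟩ := hP
  exact ⟨.X * (T.comp (.X + .C g * .X) + 1) + 1, .X + .C g * .X,
    (hP.loop s hdec).mono (by simp) (by simp)⟩

end Tame

/-! ### Programs that read stacks bit by bit -/

local infixr:60 " ⨾ " => Prog.seq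

/-- Pop a bit `b` off stack `r` and continue with `P b`; continue with `E` if the stack is empty. -/
def popCases (r : ℕ) (E : Prog) (P : Bool → Prog) : Prog :=
  .branch r E (.pop r ⨾ P false) (.pop r ⨾ P true)

/-- Pop stack `r` until it is empty, executing `P b` for every bit `b`. -/
def drain (r : ℕ) (P : Bool → Prog) : Prog := .loop r (popCases r .skip P)

/-- Move the top bit of stack `r`, if there is one, to stack `s`. -/
def move (r s : ℕ) : Prog := popCases r .skip (.push s)

/-- Copy the top bit of stack `r` to stack `s`, reading the bit `0` off an empty stack. -/
def peek (r s : ℕ) : Prog := popCases r (.push s false) fun b => .push r b ⨾ .push s b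

/-- The top of stack `r` becomes the bottom of what is added to stack `s`. -/
def moveAll (r s : ℕ) : Prog := drain r (.push s)

/-- One iteration of `scan`: read a `1` and an item, or read the `0` that ends the list. -/
def scanBody (f r : ℕ) (P : Prog) : Prog :=
  .pop f ⨾ popCases r .skip fun b => bif b then .push f true ⨾ P else .skip

/-- Read a list of items from stack `r`, executing `P` to read each of them. An item is announced by
a `1`, the end of the list by a `0`. Stack `f` is nonempty as long as the end has not been reached;
it would stay so on a malformed input, were it not popped first in each iteration. -/
def scan (f r : ℕ) (P : Prog) : Prog := .push f true ⨾ .loop f (scanBody f r P)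

theorem den_popCases_nil {E : Prog} {F : Bool → Prog} (h : σ r = []) :
    den O (popCases r E F) σ = den O E σ := by
  simp only [popCases, den, h]

theorem den_popCases_cons {E : Prog} {F : Bool → Prog} {b : Bool} {l : List Bool}
    (h : σ r = b :: l) : den O (popCases r E F) σ = den O (F b) (update σ r l) := by
  cases b <;> simp only [popCases, den, h, List.tail_cons]

section Resources

variable {g f : ℕ} {E : Prog} {F : Bool → Prog}

/-- The branches for nonempty stacks may use the space of the bit that has been popped. -/
theorem RunsIn.popCases {T G G' : ℕ → ℕ} (hE : RunsIn O E T G) (hF : ∀ b, RunsIn O (F b) T G')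
    (hG : ∀ m, G' m ≤ G (m + 1)) : RunsIn O (popCases r E F) (fun m => T m + 3) G := by
  intro σ m hσ
  rcases h : σ r with _ | ⟨b, l⟩
  · obtain ⟨hsize, t, ht, hexec⟩ := hE σ m hσ
    rw [den_popCases_nil h]
    exact ⟨hsize, t + 1, by lia,
      .cons_step (Q := E) (fun _ _ => by simp only [Certification.popCases, step, h]) hexec⟩
  · obtain ⟨m, rfl⟩ : ∃ m', m = m' + 1 := Nat.exists_eq_add_one.2 <| by
      have := hσ {r}
      simp only [size, Finset.sum_singleton, h, List.length_cons] at this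
      lia
    have hpop : SizeLE (update σ r l) m := hσ.update (by rw [h, List.length_cons]; lia)
    obtain ⟨-, t, ht, hexec⟩ := hF b _ _ (hpop.mono m.le_succ)
    rw [den_popCases_cons h]
    exact ⟨(hF b _ m hpop).1.mono (hG m), 1 + t + 1 + 1, by lia,
      .cons_step (Q := .pop r ⨾ F b)
        (fun _ _ => by cases b <;> simp only [Certification.popCases, step, h])
        (.seq (.of_step fun _ _ => by simp only [step, h, List.tail_cons]) hexec)⟩

theorem tame_popCases (hE : Tame O E g) (hF : ∀ b, Tame O (F b) (g + 1)) :
    Tame O (popCases r E F) g := by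
  obtain ⟨T, hE⟩ := hE
  choose T' hF using hF
  have h : RunsIn O (popCases r E F) (fun m => (T + T' false + T' true).eval m + 3) (· + g) :=
    .popCases (hE.mono (by simp [add_assoc]) fun _ => le_rfl)
      (fun b => (hF b).mono (eval_apply_le_eval_add T T' b) fun _ => le_rfl) fun m => by lia
  exact ⟨T + T' false + T' true + 3, h.mono (by simp) fun _ => le_rfl⟩

theorem PolyTime.popCases (hE : PolyTime O E) (hF : ∀ b, PolyTime O (F b)) :
    PolyTime O (popCases r E F) := by
  obtain ⟨T, G, hE⟩ := hE
  choose T' G' hF using hF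
  have h : RunsIn O (Certification.popCases r E F)
      (fun m => (T + T' false + T' true).eval m + 3) (fun m => (G + G' false + G' true).eval m) :=
    .popCases (hE.mono (by simp [add_assoc]) (by simp [add_assoc]))
      (fun b => (hF b).mono (eval_apply_le_eval_add T T' b) (eval_apply_le_eval_add G G' b))
      fun m => monotone_eval _ m.le_succ
  exact ⟨T + T' false + T' true + 3, _, h.mono (by simp) fun _ => le_rfl⟩

theorem tame_move (r s : ℕ) : Tame O (move r s) 0 :=
  tame_popCases tame_skip (tame_push s)

theorem tame_peek (r s : ℕ) : Tame O (peek r s) 1 :=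
  tame_popCases (tame_push s false) fun b => (tame_push r b).seq (tame_push s b)

theorem size_popCases_skip_lt (hr : ∀ b, r ∉ pushes (F b)) (σ : Store) (h : σ r ≠ []) :
    size {r} (den O (popCases r .skip F) σ) < size {r} σ := by
  obtain ⟨b, l, h⟩ := List.exists_cons_of_ne_nil h
  rw [den_popCases_cons h]
  calc size {r} (den O (F b) (update σ r l))
      ≤ size {r} (update σ r l) := size_den_le (by simpa using hr b) _
    _ < size {r} σ := by simp [size, h]

theorem tame_drain (hF : ∀ b, Tame O (F b) 1) (hr : ∀ b, r ∉ pushes (F b)) :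
    Tame O (drain r F) 0 :=
  (tame_popCases tame_skip hF).loop {r} (size_popCases_skip_lt hr)

theorem polyTime_drain (hF : ∀ b, Tame O (F b) (g + 1)) (hr : ∀ b, r ∉ pushes (F b)) :
    PolyTime O (drain r F) :=
  (tame_popCases (tame_skip.mono g.zero_le) hF).polyTime_loop {r} (size_popCases_skip_lt hr)

theorem tame_moveAll {s : ℕ} (hs : r ≠ s) : Tame O (moveAll r s) 0 :=
  tame_drain (tame_push s) fun _ => by simpa [pushes]

theorem tame_scanBody (hP : Tame O P g) : Tame O (scanBody f r P) g := by
  refine ((tame_pop f).seq (tame_popCases (tame_skip.mono g.zero_le) ?_)).mono (zero_add g).le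
  rintro (_ | _)
  · exact tame_skip.mono (Nat.zero_le _)
  · exact ((tame_push f true).seq hP).mono (by lia)

theorem size_scanBody_lt (hfr : f ≠ r) (hP : Disjoint {f, r} (pushes P)) (σ : Store)
    (h : σ f ≠ []) : size {f, r} (den O (scanBody f r P) σ) < size {f, r} σ := by
  obtain ⟨b, l, h⟩ := List.exists_cons_of_ne_nil h
  have hr : update σ f l r = σ r := update_of_ne hfr.symm _ _
  rw [scanBody, den, den, h, List.tail_cons]
  rcases h' : σ r with _ | ⟨_ | _, l'⟩
  · rw [den_popCases_nil (hr.trans h')]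
    simp [den, size, Finset.sum_pair hfr, h, h', hfr.symm]
  · rw [den_popCases_cons (hr.trans h')]
    simp only [size, cond_false, den, Finset.sum_pair hfr, ne_eq, hfr, not_false_eq_true,
      update_of_ne, update_self, h, h', List.length_cons]
    lia
  · rw [den_popCases_cons (hr.trans h'), cond_true, den]
    refine (size_den_le hP _).trans_lt ?_
    simp [den, size, Finset.sum_pair hfr, h, h', hfr, hfr.symm]

theorem tame_scan (hP : Tame O P 0) (hfr : f ≠ r) (hpush : Disjoint {f, r} (pushes P)) :
    Tame O (scan f r P) 1 :=
  (tame_push f true).seq ((tame_scanBody hP).loop _ (size_scanBody_lt hfr hpush))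

theorem polyTime_scan (hP : Tame O P g) (hfr : f ≠ r) (hpush : Disjoint {f, r} (pushes P)) :
    PolyTime O (scan f r P) :=
  (tame_push f true).polyTime.seq
    ((tame_scanBody hP).polyTime_loop _ (size_scanBody_lt hfr hpush))

end Resources

/-! ### Specifications of the stack operations -/

/-- As a simp lemma this sorts updates by their stacks, which makes stores comparable. The `+ 0`
prevents `simp` from treating it as a permutation lemma, with an order of its own. -/
theorem update_comm_of_lt {s : ℕ} (h : r < s) (l l' : List Bool) :
    update (update σ s l') r l = update (update σ r l) (s + 0) l' :=
  update_comm h.ne' l' l σ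

theorem update_of_eq {l : List Bool} (h : σ r = l) : update σ r l = σ :=
  update_eq_self_iff.2 h.symm

theorem den_popCases {E : Prog} {F : Bool → Prog} :
    den O (popCases r E F) σ =
      match σ r with
      | [] => den O E σ
      | b :: l => den O (F b) (update σ r l) := by
  rcases h : σ r with _ | ⟨b, l⟩
  · exact den_popCases_nil h
  · exact den_popCases_cons h

theorem den_move {s : ℕ} (hs : r ≠ s) (σ : Store) :
    den O (move r s) σ = update (update σ r (σ r).tail) s ((σ r).head?.toList ++ σ s) := by
  rcases h : σ r with _ | ⟨b, l⟩
  · rw [move, den_popCases_nil h, den, List.tail_nil, ← h, update_eq_self]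
    simp [h]
  · rw [move, den_popCases_cons h, den, update_of_ne hs.symm]
    simp

theorem den_peek {s : ℕ} (hs : r ≠ s) (σ : Store) :
    den O (peek r s) σ = update σ s ((σ r).headD false :: σ s) := by
  rcases h : σ r with _ | ⟨b, l⟩
  · rw [peek, den_popCases_nil h, den, List.headD_nil]
  · rw [peek, den_popCases_cons h, den, den, den]
    rw [List.headD_cons, update_of_ne hs.symm, update_of_ne hs.symm, update_self, update_idem,
      ← h, update_eq_self]

/-- In `s d l` the bits of the items in `d` have been popped off stack `r`, those of the items in
`l` have not. -/
theorem den_drain {α : Type*} {F : Bool → Prog} (s : List α → List α → Store) (bit : α → Bool)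
    (hr : ∀ d l, s d l r = l.map bit)
    (hF : ∀ d a l, den O (F (bit a)) (update (s d (a :: l)) r (l.map bit)) = s (d ++ [a]) l)
    (d l : List α) : den O (drain r F) (s d l) = s (d ++ l) [] := by
  induction l generalizing d with
  | nil => rw [drain, den_loop_of_eq_nil (hr d []), List.append_nil]
  | cons a l ih =>
    have hbody : den O (popCases r .skip F) (s d (a :: l)) = s (d ++ [a]) l := by
      rw [den_popCases_cons (hr d (a :: l)), hF]
    have hne : s d (a :: l) r ≠ [] := by simp [hr]
    rw [List.append_cons d, ← ih, drain, den_loop_of_ne_nil hne, hbody]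

theorem den_moveAll {s : ℕ} (hs : r ≠ s) (σ : Store) :
    den O (moveAll r s) σ = update (update σ r []) s ((σ r).reverse ++ σ s) := by
  have h := den_drain (O := O) (r := r) (F := .push s)
    (fun d l => update (update σ r l) s (d.reverse ++ σ s)) id
    (fun d l => by simp [hs]) (fun d a l => ?_) [] (σ r)
  · simpa [moveAll] using h
  · rw [den, update_comm hs.symm, update_idem]
    simp [update_comm hs]

/-- In `s d` the items in `d` have been read. -/
theorem den_scan {α : Type*} {f : ℕ} (s : List α → Store) (enc : α → List Bool)
    (hfr : f ≠ r) (hf : ∀ d, s d f = [])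
    (hP : ∀ d a v, den O P (update (update (s d) r (enc a ++ v)) f [true]) =
      update (update (s (d ++ [a])) r v) f [true]) (l : List α) (v : List Bool) :
    den O (scan f r P) (update (s []) r (l.flatMap (fun a => true :: enc a) ++ false :: v)) =
      update (s l) r v := by
  have hloop : ∀ d l, den O (.loop f (scanBody f r P))
      (update (update (s d) r (l.flatMap (fun a => true :: enc a) ++ false :: v)) f [true]) =
        update (s (d ++ l)) r v := by
    intro d l
    induction l generalizing d with
    | nil =>
      have hend : den O (scanBody f r P) (update (update (s d) r (false :: v)) f [true]) =
          update (s d) r v := by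
        rw [scanBody, den, den, den_popCases_cons (b := false) (l := v) (by simp [hfr.symm]),
          cond_false, den]
        ext1 k
        grind
      rw [den_loop_of_ne_nil (by simp), List.flatMap_nil, List.nil_append, hend,
        den_loop_of_eq_nil (by simp [hfr, hf]), List.append_nil]
    | cons a l ih =>
      have hbody : den O (scanBody f r P) (update (update (s d) r
          ((a :: l).flatMap (fun a => true :: enc a) ++ false :: v)) f [true]) =
          update (update (s (d ++ [a])) r
            (l.flatMap (fun a => true :: enc a) ++ false :: v)) f [true] := by
        rw [scanBody, den, den, den_popCases_cons (b := true)
            (l := enc a ++ (l.flatMap (fun a => true :: enc a) ++ false :: v)) (by simp [hfr.symm]),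
          cond_true, den, den, ← hP]
        congr 1
        ext1 k
        grind
      rw [List.append_cons d, ← ih, den_loop_of_ne_nil (by simp), hbody]
  rw [scan, den, den, ← List.nil_append l, ← hloop]
  simp [hfr, hf]

theorem den_scan_encodeNat {f : ℕ} (s : ℕ → Store) (hfr : f ≠ r) (hf : ∀ j, s j f = [])
    (hP : ∀ j v, den O P (update (update (s j) r v) f [true]) =
      update (update (s (j + 1)) r v) f [true]) (k : ℕ) (v : List Bool) :
    den O (scan f r P) (update (s 0) r (encodeNat k ++ v)) = update (s k) r v := by
  have h := den_scan (O := O) (P := P) (fun d : List Unit => s d.length) (fun _ => []) hfr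
    (fun _ => hf _) (by simpa using fun _ => hP _) (List.replicate k ()) v
  simpa [encodeNat, List.flatMap_replicate] using h

/-! ### The verifier -/

/-! The machine receives a circuit on `code` and a point on `input`, the verifier a query on `code`
and a witness on `witness`, which is the same stack as `input`. The output is left on `code`. -/

namespace Stack

@[simp] abbrev code : ℕ := 0
@[simp] abbrev input : ℕ := 1
@[simp] abbrev witness : ℕ := 1
@[simp] abbrev pfx : ℕ := 2
@[simp] abbrev flag : ℕ := 3
@[simp] abbrev innerFlag : ℕ := 4
@[simp] abbrev inputs : ℕ := 5
@[simp] abbrev target : ℕ := 6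
@[simp] abbrev wires : ℕ := 7
@[simp] abbrev values : ℕ := 8
@[simp] abbrev scratch : ℕ := 9
@[simp] abbrev point : ℕ := 10
@[simp] abbrev marks : ℕ := 11
@[simp] abbrev roundCount : ℕ := 12
@[simp] abbrev coordCount : ℕ := 13
@[simp] abbrev spare : ℕ := 14
@[simp] abbrev answer : ℕ := 15

end Stack

open Stack

/-- Push on `values` the value of the wire whose number is read from `code`. -/
def lookup : Prog :=
  scan innerFlag code (move wires scratch) ⨾
    peek wires values ⨾ moveAll scratch wires

theorem den_lookup {i : ℕ} {v : List Bool} (hcode : σ code = encodeNat i ++ v)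
    (hflag : σ innerFlag = []) (hscratch : σ scratch = []) :
    den O lookup σ = update (update σ code v) values ((σ wires).getD i false :: σ values) := by
  set ws := σ wires with hws
  let s j := update (update σ wires (ws.drop j)) scratch (ws.take j).reverse
  have hσ : σ = update (s 0) code (encodeNat i ++ v) := by
    simp [s, update_of_eq, ← hws, hscratch, hcode]
  have hscan : den O (scan innerFlag code (move wires scratch)) σ = update (s i) code v := by
    rw (occs := [1]) [hσ]
    refine den_scan_encodeNat s (by decide) (by simp [s, hflag]) (fun j v => ?_) i v
    have htake : (ws.take (j + 1)).reverse = ws[j]?.toList ++ (ws.take j).reverse := by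
      rw [List.take_add_one, List.reverse_append]
      cases ws[j]? <;> rfl
    rw [den_move (r := wires) (by decide)]
    simp [s, htake, update_comm_of_lt]
  rw [lookup, den, hscan, den, den_peek (by decide), den_moveAll (by decide)]
  simp [s, update_comm_of_lt, update_of_eq, ← hws, hscratch]

/-- Push on `values` the result of `op` on the wires whose numbers are read from `code`. -/
def applyOp (op : Bool → Bool → Bool) : Prog :=
  lookup ⨾ lookup ⨾
    popCases values .skip fun v => popCases values .skip fun u => .push values (op u v)

theorem den_applyOp {op : Bool → Bool → Bool} {i j : ℕ} {v : List Bool}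
    (hcode : σ code = encodeNat i ++ (encodeNat j ++ v)) (hflag : σ innerFlag = [])
    (hscratch : σ scratch = []) :
    den O (applyOp op) σ = update (update σ code v) values
      (op ((σ wires).getD i false) ((σ wires).getD j false) :: σ values) := by
  rw [applyOp, den, den, den_lookup hcode hflag hscratch,
    den_lookup (i := j) (v := v) (by simp) (by simpa) (by simpa)]
  simp [den_popCases, den, update_comm_of_lt]

/-- Push on `values` the value of a gate read from `code`, after the two bits `b` and `c` by which
`Gate.encode` denotes the kind of the gate. -/
def evalKind : Bool → Bool → Prog
  | false, false => move code values
  | false, true => lookup ⨾ popCases values .skip fun u => .push values !u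
  | true, false => applyOp and
  | true, true => applyOp or

/-- Add to the bottom of `wires` the value of a gate read from `code`. -/
def evalGate : Prog :=
  popCases code .skip (fun b => popCases code .skip fun c => evalKind b c) ⨾
    moveAll wires scratch ⨾ move values scratch ⨾ moveAll scratch wires

theorem den_evalGate {g : Gate} {v : List Bool} (hcode : σ code = g.encode ++ v)
    (hflag : σ innerFlag = []) (hscratch : σ scratch = []) (hvalues : σ values = []) :
    den O evalGate σ = update (update σ code v) wires (σ wires ++ [g.eval (σ wires)]) := by
  have hvalue : den O (popCases code .skip fun b => popCases code .skip fun c => evalKind b c) σ =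
      update (update σ code v) values [g.eval (σ wires)] := by
    rcases g with b | i | ⟨i, j⟩ | ⟨i, j⟩ <;>
      simp only [Gate.encode, List.cons_append, List.nil_append, List.append_assoc] at hcode <;>
      simp only [den_popCases, hcode, update_self, update_idem, evalKind]
    · simp [Gate.eval, den_move, hvalues]
    · rw [den, den_lookup (i := i) (v := v) (by simp) (by simpa) (by simpa)]
      simp [den_popCases, den, hvalues, Gate.eval]
    · rw [den_applyOp (i := i) (j := j) (v := v) (by simp) (by simpa) (by simpa)]
      simp [hvalues, Gate.eval]
    · rw [den_applyOp (i := i) (j := j) (v := v) (by simp) (by simpa) (by simpa)]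
      simp [hvalues, Gate.eval]
  rw [evalGate, den, hvalue, den, den_moveAll (by decide), den, den_move (by decide),
    den_moveAll (by decide)]
  simp [update_comm_of_lt, update_of_eq, hscratch, hvalues]

/-- Add an input bit: the one on top of `code` if `u` is set, the one on top of `witness` if not. -/
def readBit (u : Bool) : Prog :=
  bif u then .pop witness ⨾ move code inputs
  else .pop code ⨾ popCases witness (.push inputs false) (.push inputs)

/-- Read a coordinate from `code`: its mark, which is overridden by the one on top of `pfx`, if
any, and its bit. -/
def readInput : Prog :=
  popCases code .skip fun u => popCases pfx (readBit u) readBit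

/-- Check that the circuit in a query has the value in the query on the input that agrees with the
point in the query on the marked coordinates and with the witness elsewhere. -/
def verifier : Prog :=
  scan flag code (move code pfx) ⨾ scan flag code readInput ⨾ moveAll inputs wires ⨾
    move code target ⨾ scan flag code .skip ⨾ scan flag code evalGate ⨾ lookup ⨾
    popCases target .skip fun b => popCases values .skip fun v => .push code (v == b)

/-- The query asks whether `C` attains the value `b` on an input that agrees with `x` wherever the
mark is set. The mark of coordinate `i` is `a[i]`, or `u i` if `a` is too short. The
marks in `a` come first and in reverse order, so that one more of them can be pushed on top. -/
def encodeQuery {n : ℕ} (C : Circuit n) (b : Bool) (u x : Fin n → Bool) (a : List Bool) :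
    List Bool :=
  a.reverse.flatMap (fun v => true :: [v]) ++ false ::
    ((List.ofFn fun i => (u i, x i)).flatMap (fun c => true :: [c.1, c.2]) ++ false ::
      b :: C.encode)

/-- The input on which the verifier evaluates the circuit in a query. -/
def assignment {n : ℕ} (u x : Fin n → Bool) (a w : List Bool) (i : Fin n) : Bool :=
  bif a.getD i (u i) then x i else w.getD i false

theorem den_readInput {u x : Bool} {v : List Bool} (hcode : σ code = u :: x :: v) :
    den O readInput σ = update (update (update (update σ code v) witness (σ witness).tail) pfx
      (σ pfx).tail) inputs
        ((bif (σ pfx).headD u then x else (σ witness).headD false) :: σ inputs) := by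
  rcases hp : σ pfx with _ | ⟨_ | _, p⟩ <;> rcases hw : σ witness with _ | ⟨c, w⟩ <;> cases u <;>
    simp [readInput, readBit, den_popCases, den, den_move, hcode, hp, hw, update_comm_of_lt,
      update_of_eq]

theorem den_scan_readInput (cs : List (Bool × Bool)) {v : List Bool}
    (hcode : σ code = cs.flatMap (fun c => true :: [c.1, c.2]) ++ false :: v)
    (hflag : σ flag = []) :
    den O (scan flag code readInput) σ =
      update (update (update (update σ code v) witness ((σ witness).drop cs.length)) pfx
        ((σ pfx).drop cs.length)) inputs ((cs.mapIdx fun i c =>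
          bif (σ pfx).getD i c.1 then c.2 else (σ witness).getD i false).reverse ++ σ inputs) := by
  let s (d : List (Bool × Bool)) := update (update (update σ witness
    ((σ witness).drop d.length)) pfx ((σ pfx).drop d.length)) inputs
      ((d.mapIdx fun i c =>
        bif (σ pfx).getD i c.1 then c.2 else (σ witness).getD i false).reverse ++ σ inputs)
  have hσ : σ = update (s []) code (cs.flatMap (fun c => true :: [c.1, c.2]) ++ false :: v) := by
    simp [s, update_of_eq, hcode]
  rw (occs := [1]) [hσ]
  rw [den_scan s (fun c => [c.1, c.2]) (by decide) (by simp [s, hflag])]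
  · simp [s, update_comm_of_lt]
  · intro d c v
    rw [den_readInput (u := c.1) (x := c.2) (v := v) (by simp)]
    simp [s, update_comm_of_lt, List.mapIdx_concat, List.headD_eq_head?_getD]

theorem den_scan_evalGate (gs : List Gate) {v : List Bool}
    (hcode : σ code = gs.flatMap (fun g => true :: g.encode) ++ false :: v)
    (hflag : σ flag = []) (hinner : σ innerFlag = []) (hscratch : σ scratch = [])
    (hvalues : σ values = []) :
    den O (scan flag code evalGate) σ = update (update σ code v) wires
      (gs.foldl (fun ws g => ws ++ [g.eval ws]) (σ wires)) := by
  let s (d : List Gate) :=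
    update σ wires (d.foldl (fun ws g => ws ++ [g.eval ws]) (σ wires))
  have hσ : σ = update (s []) code (gs.flatMap (fun g => true :: g.encode) ++ false :: v) := by
    simp [s, update_of_eq, hcode]
  rw (occs := [1]) [hσ]
  rw [den_scan s Gate.encode (by decide) (by simp [s, hflag])]
  · simp [s, update_comm_of_lt]
  · intro d g v
    rw [den_evalGate (g := g) (v := v) (by simp) (by simpa [s]) (by simpa [s]) (by simpa [s])]
    simp [s, update_comm_of_lt]

theorem den_scan_move {l v : List Bool} (hcode : σ code = l.flatMap (fun b => true :: [b]) ++
    false :: v) (hflag : σ flag = []) :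
    den O (scan flag code (move code pfx)) σ =
      update (update σ code v) pfx (l.reverse ++ σ pfx) := by
  let s (d : List Bool) := update σ pfx (d.reverse ++ σ pfx)
  have hσ : σ = update (s []) code (l.flatMap (fun b => true :: [b]) ++ false :: v) := by
    simp [s, update_of_eq, hcode]
  rw (occs := [1]) [hσ]
  rw [den_scan s (fun b => [b]) (by decide) (by simp [s, hflag])]
  · simp [s, update_comm_of_lt]
  · intro d b v
    rw [den_move (by decide)]
    simp [s, update_comm_of_lt]

theorem den_scan_skip {k : ℕ} {v : List Bool} (hcode : σ code = encodeNat k ++ v)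
    (hflag : σ flag = []) : den O (scan flag code .skip) σ = update σ code v := by
  have h := den_scan_encodeNat (O := O) (r := code) (P := .skip) (fun _ => σ) (f := flag)
    (by decide) (fun _ => hflag) (fun _ _ => rfl) k v
  rwa [update_of_eq hcode] at h

theorem den_verifier {n : ℕ} (C : Circuit n) (b : Bool) (u x : Fin n → Bool) (a w : List Bool) :
    den O verifier (inputStore (encodeQuery C b u x a) w) code =
      [C.eval (assignment u x a w) == b] := by
  set cs := List.ofFn fun i => (u i, x i) with hcs
  set core := cs.flatMap (fun c => true :: [c.1, c.2]) ++ false :: b :: C.encode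
  set τ := inputStore (encodeQuery C b u x a) w
  have hnil : ∀ r, τ (r + 2) = [] := fun _ => rfl
  have hinputs : (cs.mapIdx fun i c => bif a.getD i c.1 then c.2 else w.getD i false) =
      List.ofFn (assignment u x a w) := by
    apply List.ext_getElem <;> simp [hcs, assignment]
  rw [verifier, den, den_scan_move (l := a.reverse) (v := core) rfl rfl, den,
    den_scan_readInput cs (v := b :: C.encode) (by simp [core]) (by simp [hnil]),
    den, den_moveAll (by decide), den, den_move (by decide), den,
    den_scan_skip (k := n) (v := C.gates.flatMap (fun g => true :: g.encode) ++ false ::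
      encodeNat C.out) (by simp [Circuit.encode]) (by simp [hnil]), den,
    den_scan_evalGate C.gates (v := encodeNat C.out) (by simp) (by simp [hnil]) (by simp [hnil])
      (by simp [hnil]) (by simp [hnil]), den,
    den_lookup (i := C.out) (v := []) (by simp) (by simp [hnil]) (by simp [hnil])]
  simp [den_popCases, den, ← hinputs, hnil, Circuit.eval, τ, inputStore]

theorem isDeterministic_verifier : verifier.IsDeterministic := by
  simp [verifier, scan, scanBody, popCases, moveAll, drain, move, readInput, readBit, evalGate,
    evalKind, applyOp, lookup, peek, Prog.IsDeterministic]

theorem tame_lookup : Tame O lookup 2 :=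
  (tame_scan (tame_move _ _) (by decide) (by decide)).seq
    ((tame_peek _ _).seq (tame_moveAll (by decide)))

theorem tame_applyOp (op : Bool → Bool → Bool) : Tame O (applyOp op) 4 :=
  tame_lookup.seq (tame_lookup.seq (tame_popCases tame_skip fun _ =>
    (tame_popCases tame_skip fun _ => tame_push _ _).mono zero_le_one))

theorem tame_evalKind (b c : Bool) : Tame O (evalKind b c) 4 := by
  rcases b <;> rcases c
  · exact (tame_move _ _).mono (by decide)
  · exact (tame_lookup.seq (tame_popCases tame_skip fun _ => tame_push _ _)).mono (by decide)
  · exact tame_applyOp and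
  · exact tame_applyOp or

theorem tame_evalGate : Tame O evalGate 4 :=
  (tame_popCases (tame_skip.mono (by decide)) fun b =>
    tame_popCases (g := 5) (tame_skip.mono (by decide)) fun c =>
      (tame_evalKind b c).mono (by decide)).seq
    ((tame_moveAll (by decide)).seq ((tame_move _ _).seq (tame_moveAll (by decide))))

theorem tame_readBit (u : Bool) : Tame O (readBit u) 1 := by
  cases u
  · exact (tame_pop _).seq (tame_popCases (tame_push _ _) fun b =>
      (tame_push _ b).mono one_le_two)
  · exact ((tame_pop _).seq (tame_move _ _)).mono zero_le_one

theorem tame_readInput : Tame O readInput 0 :=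
  tame_popCases tame_skip fun u => tame_popCases (tame_readBit u) fun b =>
    (tame_readBit b).mono one_le_two

theorem polyTime_verifier : PolyTime O verifier :=
  (polyTime_scan (tame_move _ _) (by decide) (by decide)).seq <|
    (polyTime_scan tame_readInput (by decide) (by decide)).seq <|
    (tame_moveAll (by decide)).polyTime.seq <| (tame_move _ _).polyTime.seq <|
    (polyTime_scan tame_skip (by decide) (by decide)).seq <|
    (polyTime_scan tame_evalGate (by decide) (by decide)).seq <|
    tame_lookup.polyTime.seq <| Tame.polyTime <| tame_popCases tame_skip fun _ =>
      tame_popCases (tame_skip.mono zero_le_one) fun _ => (tame_push _ _).mono (by decide)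

/-! ### The oracle -/

theorem sizeLE_inputStore (u v : List Bool) : SizeLE (inputStore u v) (u.length + v.length) := by
  have hstore : inputStore u v = update (update (fun _ => []) 0 u) 1 v := by
    funext r
    rcases r with _ | _ | r <;> rfl
  rw [hstore]
  exact ((sizeLE_nil.update_add 0 u).update_add 1 v).mono (by rw [zero_add])

/-- The queries that the verifier accepts with a witness no longer than the query. -/
def oracle : Language Bool :=
  {q | ∃ w : List Bool, w.length ≤ q.length ∧ den 0 verifier (inputStore q w) code = [true]}

theorem inNP_oracle : InNP oracle := by
  obtain ⟨p, G, hp⟩ := polyTime_verifier (O := 0)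
  have hrun : ∀ q w coins : List Bool, coins.length = p.eval (q.length + w.length) →
      run 0 verifier (inputStore q w) coins = ⟨[], den 0 verifier (inputStore q w)⟩ := by
    intro q w coins hcoins
    obtain ⟨-, t, ht, hexec⟩ := hp _ _ (sizeLE_inputStore q w)
    exact hexec.run_eq (hcoins ▸ ht)
  refine ⟨verifier, p, .X, isDeterministic_verifier, fun q w coins hcoins => ?_, fun q => ?_⟩
  · rw [hrun q w coins hcoins]
  · simp only [hrun q _ _ List.length_replicate, Polynomial.eval_X]
    rfl

theorem encodeQuery_mem_oracle {n : ℕ} (C : Circuit n) (b : Bool) (x : Fin n → Bool)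
    (U : Finset (Fin n)) (a : List Bool) :
    encodeQuery C b (fun i => decide (i ∈ U)) x a ∈ oracle ↔
      Attains C.eval x b (overrideSet U a) := by
  set q := encodeQuery C b (fun i => decide (i ∈ U)) x a with hq
  have hn : n ≤ q.length := by
    simp only [q, encodeQuery, Circuit.encode, encodeNat, List.length_append, List.length_cons,
      List.length_replicate]
    lia
  constructor
  · rintro ⟨w, -, hw⟩
    rw [hq, den_verifier] at hw
    refine ⟨assignment (fun i => decide (i ∈ U)) x a w, fun i hi => ?_, by simpa using hw⟩
    grind [overrideSet, assignment]
  · rintro ⟨y, hy, hb⟩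
    have hassign : assignment (fun i => decide (i ∈ U)) x a (List.ofFn y) = y := by
      funext i
      have hyi := hy i
      grind [overrideSet, assignment]
    refine ⟨List.ofFn y, by simpa using hn, ?_⟩
    rw [hq, den_verifier, hassign, hb, beq_self_eq_true]

/-! ### The algorithm -/

/-- Store the input, an empty set of marked coordinates, and the number of coordinates. -/
def prepare : Prog :=
  drain input fun v =>
    .push point v ⨾ .push marks false ⨾ .push roundCount true ⨾ .push coordCount true

/-- Turn the circuit on `code` into a query about the value `b`, with no marks overridden. -/
def build (b : Bool) : Prog :=
  .push code b ⨾ .push code false ⨾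
    drain point (fun v => .push code v ⨾ move marks code ⨾ .push code true) ⨾ .push code false

/-- Override the mark of one more coordinate: set it if the oracle then says yes, else clear it. -/
def extendPrefix : Prog :=
  .push code true ⨾ .push code true ⨾ .query code answer ⨾
    popCases answer .skip fun v => .pop code ⨾ .pop code ⨾ .push code v ⨾ .push code true

/-- Override the marks of all coordinates. -/
def extendAll : Prog :=
  drain coordCount (fun _ => extendPrefix ⨾ .push spare true) ⨾ moveAll spare coordCount

/-- Read a coordinate back from a query. It is marked from now on if it was so before, or if its
mark has been overridden and cleared. -/
def readBack : Prog :=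
  popCases code .skip (fun u =>
    popCases pfx (.push marks u) fun v => .push marks (bif v then u else true)) ⨾ move code point

/-- If `f` attains the value in the query, find a maximal set of marks for which it still does. -/
def select : Prog :=
  .query code answer ⨾ popCases answer .skip fun v => bif v then extendAll else .skip

/-- Take a query apart again, leaving the circuit on `code`. -/
def unbuild : Prog :=
  scan flag code (move code pfx) ⨾ scan flag code readBack ⨾ .pop code

/-- Replace the set `U` of marked coordinates by `nextSet f x b U`. -/
def round (b : Bool) : Prog := build b ⨾ select ⨾ unbuild

/-- Run as many rounds as there are coordinates. As `f x` is not known, both values are tried. -/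
def rounds : Prog := .loop roundCount (.pop roundCount ⨾ round true ⨾ round false)

/-- Replace the circuit on `code` by the marks. -/
def outputMarks : Prog := drain code (fun _ => .skip) ⨾ moveAll marks code

/-- The algorithm for finding a certificate. -/
def certify : Prog := prepare ⨾ rounds ⨾ outputMarks

/-- The stacks between the rounds: `U` is the set of marked coordinates, and `k` rounds remain. -/
def roundStore {n : ℕ} (C : Circuit n) (x : Fin n → Bool) (U : Finset (Fin n)) (k : ℕ) : Store :=
  update (update (update (update (update (fun _ => []) code C.encode) point (List.ofFn x).reverse)
    marks (encodeSet U).reverse) roundCount (List.replicate k true)) coordCount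
      (List.replicate n true)

section Algorithm

variable {n : ℕ} {C : Circuit n} {b : Bool} {u x : Fin n → Bool} {U : Finset (Fin n)} {k : ℕ}

theorem den_prepare : den O prepare (inputStore C.encode (List.ofFn x)) = roundStore C x ∅ n := by
  let s (d l : List Bool) : Store :=
    update (update (update (update (update (update (fun _ => []) code C.encode) input l) point
      d.reverse) marks (List.replicate d.length false)) roundCount (List.replicate d.length true))
        coordCount (List.replicate d.length true)
  have hinit : inputStore C.encode (List.ofFn x) = s [] (List.ofFn x) := by
    funext r
    rcases r with _ | _ | r <;> simp [s, inputStore, update_of_eq]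
  rw [prepare, hinit, den_drain s id (by simp [s])]
  · simp [s, roundStore, encodeSet, update_of_eq]
  · intro d v l
    simp [den, s, update_comm_of_lt, ← List.replicate_succ]

theorem den_build (cs : List (Bool × Bool)) (hpoint : σ point = (cs.map Prod.snd).reverse)
    (hmarks : σ marks = (cs.map Prod.fst).reverse) :
    den O (build b) σ = update (update (update σ code (false ::
      (cs.flatMap (fun c => true :: [c.1, c.2]) ++ false :: b :: σ code))) point []) marks [] := by
  let s (d l : List (Bool × Bool)) := update (update (update σ code
    (d.reverse.flatMap (fun c => true :: [c.1, c.2]) ++ false :: b :: σ code)) point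
      (l.map Prod.snd)) marks (l.map Prod.fst)
  have hinit : update (update σ code (b :: σ code)) code (false :: b :: σ code) =
      s [] cs.reverse := by
    simp [s, update_of_eq, hpoint, hmarks]
  rw [build, den, den, den, den, den, update_self, hinit, den_drain s Prod.snd (by simp [s])]
  · simp [s, den, update_comm_of_lt]
  · intro d c l
    simp [den, den_move, s, update_comm_of_lt]

theorem encodeQuery_append (a : List Bool) (v : Bool) :
    encodeQuery C b u x (a ++ [v]) = true :: v :: encodeQuery C b u x a := by
  simp [encodeQuery]

open Classical in
theorem den_extendPrefix {a : List Bool} (hcode : σ code = encodeQuery C b u x a)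
    (hanswer : σ answer = []) :
    den oracle extendPrefix σ = update σ code (encodeQuery C b u x
      (a ++ [decide (encodeQuery C b u x (a ++ [true]) ∈ oracle)])) := by
  simp [extendPrefix, den, den_popCases, encodeQuery_append, hcode, hanswer, update_of_eq]

theorem den_extendAll (hcode : σ code = encodeQuery C b u x []) (hanswer : σ answer = [])
    (hcount : σ coordCount = List.replicate k true) (hspare : σ spare = []) :
    den oracle extendAll σ = update σ code
      (encodeQuery C b u x (greedyBits (fun a => encodeQuery C b u x a ∈ oracle) k)) := by
  let s (d l : List Unit) := update (update (update σ code (encodeQuery C b u x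
    (greedyBits (fun a => encodeQuery C b u x a ∈ oracle) d.length))) coordCount
      (List.replicate l.length true)) spare (List.replicate d.length true)
  have hinit : σ = s [] (List.replicate k ()) := by
    simp [s, greedyBits, update_of_eq, hcode, hcount, hspare]
  rw (occs := [1]) [hinit]
  rw [extendAll, den, den_drain s (fun _ => true) (by simp [s])]
  · rw [den_moveAll (by decide)]
    simp [s, update_of_eq, hcount, hspare]
  · intro d _ l
    rw [den, den_extendPrefix (C := C) (b := b) (u := u) (x := x)
      (a := greedyBits (fun a => encodeQuery C b u x a ∈ oracle) d.length) (by simp [s])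
      (by simpa [s])]
    simp [s, den, greedyBits, update_comm_of_lt, List.replicate_succ]

theorem den_readBack {u x : Bool} {v : List Bool} (hcode : σ code = u :: x :: v) :
    den O readBack σ = update (update (update (update σ code v) pfx (σ pfx).tail) point
      (x :: σ point)) marks ((u || !(σ pfx).headD true) :: σ marks) := by
  rcases hp : σ pfx with _ | ⟨_ | _, p⟩ <;> cases u <;>
    simp [readBack, den_popCases, den, den_move, hcode, hp, update_comm_of_lt, update_of_eq]

theorem den_scan_readBack (cs : List (Bool × Bool)) {v : List Bool}
    (hcode : σ code = cs.flatMap (fun c => true :: [c.1, c.2]) ++ false :: v)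
    (hflag : σ flag = []) :
    den O (scan flag code readBack) σ =
      update (update (update (update σ code v) pfx ((σ pfx).drop cs.length)) point
        ((cs.map Prod.snd).reverse ++ σ point)) marks
          ((cs.mapIdx fun i c => c.1 || !(σ pfx).getD i true).reverse ++ σ marks) := by
  let s (d : List (Bool × Bool)) := update (update (update σ pfx ((σ pfx).drop d.length)) point
    ((d.map Prod.snd).reverse ++ σ point)) marks
      ((d.mapIdx fun i c => c.1 || !(σ pfx).getD i true).reverse ++ σ marks)
  have hσ : σ = update (s []) code (cs.flatMap (fun c => true :: [c.1, c.2]) ++ false :: v) := by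
    simp [s, update_of_eq, hcode]
  rw (occs := [1]) [hσ]
  rw [den_scan s (fun c => [c.1, c.2]) (by decide) (by simp [s, hflag])]
  · simp [s, update_comm_of_lt]
  · intro d c v
    rw [den_readBack (u := c.1) (x := c.2) (v := v) (by simp)]
    simp [s, update_comm_of_lt, List.mapIdx_concat, List.headD_eq_head?_getD]

theorem den_unbuild {a : List Bool} (hcode : σ code = encodeQuery C b u x a) (ha : a.length ≤ n)
    (hpfx : σ pfx = []) (hflag : σ flag = []) :
    den O unbuild σ = update (update (update σ code C.encode) point
      ((List.ofFn x).reverse ++ σ point)) marks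
        ((List.ofFn fun i => u i || !a.getD i true).reverse ++ σ marks) := by
  set cs := List.ofFn fun i => (u i, x i)
  have hbits : cs.map Prod.snd = List.ofFn x := by simp [cs, comp_def]
  have hmarks : (cs.mapIdx fun i c => c.1 || !a.getD i true) =
      List.ofFn fun i => u i || !a.getD i true := by
    apply List.ext_getElem <;> simp [cs]
  rw [unbuild, den, den_scan_move (l := a.reverse) hcode hflag, den,
    den_scan_readBack cs (v := b :: C.encode) (by simp [cs]) (by simpa)]
  have hdrop : a.drop cs.length = [] := by simpa [cs]
  rw [← hmarks]
  simp [den, hpfx, hbits, hdrop, update_comm_of_lt, update_of_eq]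

open Classical in
/-- The overriding marks found by `select`. -/
noncomputable def selectBits (f : (Fin n → Bool) → Bool) (x : Fin n → Bool) (b : Bool)
    (U : Finset (Fin n)) : List Bool :=
  if Attains f x b U then greedyBits (fun a => Attains f x b (overrideSet U a)) n else []

theorem length_selectBits_le (f : (Fin n → Bool) → Bool) (x : Fin n → Bool) (b : Bool)
    (U : Finset (Fin n)) : (selectBits f x b U).length ≤ n := by
  rw [selectBits]
  split_ifs <;> simp [length_greedyBits]

theorem encodeSet_nextSet (f : (Fin n → Bool) → Bool) (x : Fin n → Bool) (b : Bool)
    (U : Finset (Fin n)) : encodeSet (nextSet f x b U) =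
      List.ofFn fun i => decide (i ∈ U) || !(selectBits f x b U).getD i true := by
  rw [encodeSet, nextSet, selectBits]
  congr 1 with i
  split_ifs
  · have hlength := length_greedyBits (fun a => Attains f x b (overrideSet U a)) n
    grind [greedySet, overrideSet, Finset.mem_compl]
  · simp

theorem den_select (hcode : σ code = encodeQuery C b (fun i => decide (i ∈ U)) x [])
    (hanswer : σ answer = []) (hcount : σ coordCount = List.replicate n true)
    (hspare : σ spare = []) :
    den oracle select σ = update σ code (encodeQuery C b (fun i => decide (i ∈ U)) x
      (selectBits C.eval x b U)) := by
  have hempty : encodeQuery C b (fun i => decide (i ∈ U)) x [] ∈ oracle ↔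
      Attains C.eval x b U := by
    rw [encodeQuery_mem_oracle, overrideSet_nil]
  have hall := den_extendAll hcode hanswer hcount hspare
  simp only [encodeQuery_mem_oracle] at hall
  by_cases h : Attains C.eval x b U
  · simp [select, den, den_popCases, hcode, hempty, selectBits, h, hall, hanswer, update_of_eq]
  · simp [select, den, den_popCases, hcode, hempty, selectBits, h, hanswer, update_of_eq]

theorem den_round (x : Fin n → Bool) (U : Finset (Fin n)) (k : ℕ) :
    den oracle (round b) (roundStore C x U k) = roundStore C x (nextSet C.eval x b U) k := by
  have hbuild : den oracle (build b) (roundStore C x U k) =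
      update (update (update (roundStore C x U k) code
        (encodeQuery C b (fun i => decide (i ∈ U)) x [])) point []) marks [] := by
    rw [den_build (List.ofFn fun i => (decide (i ∈ U), x i)) (by simp [roundStore, comp_def])
      (by simp [roundStore, encodeSet, comp_def])]
    simp [encodeQuery, roundStore]
  rw [round, den, hbuild, den, den_select (C := C) (b := b) (x := x) (U := U) (by simp)
    (by simp [roundStore]) (by simp [roundStore]) (by simp [roundStore]),
    den_unbuild (update_self ..) (length_selectBits_le ..) (by simp [roundStore])
      (by simp [roundStore])]
  simp [roundStore, encodeSet_nextSet, update_comm_of_lt]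

theorem den_outputMarks (C : Circuit n) (x : Fin n → Bool) (U : Finset (Fin n)) :
    den O outputMarks (roundStore C x U k) code = encodeSet U := by
  have hdrain := den_drain (O := O) (r := code) (F := fun _ => .skip)
    (fun _ l => update (roundStore C x U k) code l) id (by simp) (by simp [den]) [] C.encode
  rw [update_of_eq (by simp [roundStore])] at hdrain
  rw [outputMarks, den, hdrain, den_moveAll (by decide)]
  simp [roundStore]

end Algorithm

/-! ### Running time of the algorithm -/

theorem polyTime_prepare : PolyTime O prepare :=
  polyTime_drain (g := 3) (fun v => (tame_push point v).seq <| (tame_push marks false).seq <|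
    (tame_push roundCount true).seq (tame_push coordCount true)) (by decide)

theorem polyTime_build (b : Bool) : PolyTime O (build b) :=
  (tame_push code b).polyTime.seq <| (tame_push code false).polyTime.seq <|
    (polyTime_drain (g := 1) (fun v => (tame_push code v).seq <|
      (tame_move marks code).seq (tame_push code true)) (by decide)).seq
    (tame_push code false).polyTime

theorem tame_extendPrefix : Tame O extendPrefix 4 :=
  (tame_push _ _).seq <| (tame_push _ _).seq <| (tame_query _ _).seq <|
    tame_popCases (tame_skip.mono zero_le_one) fun v => ((tame_pop _).seq <| (tame_pop _).seq <|
      (tame_push code v).seq (tame_push _ _)).mono (by decide)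

theorem polyTime_extendAll : PolyTime O extendAll :=
  (polyTime_drain (fun _ => tame_extendPrefix.seq (tame_push _ _)) (by decide)).seq
    (tame_moveAll (by decide)).polyTime

theorem polyTime_select : PolyTime O select :=
  (tame_query _ _).polyTime.seq <| .popCases tame_skip.polyTime fun v => by
    cases v
    · exact tame_skip.polyTime
    · exact polyTime_extendAll

theorem tame_readBack : Tame O readBack 0 :=
  (tame_popCases tame_skip fun _ => tame_popCases (tame_push _ _) fun _ =>
    (tame_push _ _).mono one_le_two).seq (tame_move _ _)

theorem polyTime_unbuild : PolyTime O unbuild :=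
  (polyTime_scan (tame_move _ _) (by decide) (by decide)).seq <|
    (polyTime_scan tame_readBack (by decide) (by decide)).seq (tame_pop _).polyTime

theorem polyTime_round (b : Bool) : PolyTime O (round b) :=
  (polyTime_build b).seq (polyTime_select.seq polyTime_unbuild)

theorem tame_outputMarks : Tame O outputMarks 0 :=
  (tame_drain (fun _ => tame_skip.mono zero_le_one) (by decide)).seq (tame_moveAll (by decide))

theorem length_encode_gate_le {m : ℕ} {g : Gate} (h : g.ArgsLt m) :
    g.encode.length ≤ 2 * m + 4 := by
  cases g <;>
    simp only [Gate.ArgsLt, Gate.encode, encodeNat, List.length_append, List.length_replicate,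
      List.length_cons, List.length_nil] at h ⊢ <;> lia

theorem length_encode_le {n : ℕ} (C : Circuit n) : C.encode.length ≤
    (n + C.size) * (2 * (n + C.size) + 5) + 2 * (n + C.size) + 3 := by
  set m := n + C.size
  have hgate : ∀ g ∈ C.gates, (true :: g.encode).length ≤ 2 * m + 5 := by
    intro g hg
    obtain ⟨k, hk, rfl⟩ := List.mem_iff_getElem.1 hg
    have hlength := length_encode_gate_le (C.argsLt k hk)
    have hkm : n + k < m := Nat.add_lt_add_left hk n
    rw [List.length_cons]
    lia
  have hgates : (C.gates.flatMap fun g => true :: g.encode).length ≤ m * (2 * m + 5) :=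
    calc (C.gates.flatMap fun g => true :: g.encode).length
        = (C.gates.map fun g => (true :: g.encode).length).sum := List.length_flatMap
      _ ≤ C.size * (2 * m + 5) := by
        simpa [Circuit.size] using List.sum_le_card_nsmul
          (C.gates.map fun g => (true :: g.encode).length) _ (by simpa using hgate)
      _ ≤ m * (2 * m + 5) := Nat.mul_le_mul_right _ (Nat.le_add_left _ n)
  have hout : C.out < m := C.outLt
  simp only [Circuit.encode, List.length_append, encodeNat, List.length_replicate, List.length_cons,
    List.length_nil]
  lia

theorem sizeLE_roundStore {n : ℕ} (C : Circuit n) (x : Fin n → Bool) (U : Finset (Fin n))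
    (k : ℕ) : SizeLE (roundStore C x U k) (C.encode.length + 3 * n + k) := by
  refine (((((sizeLE_nil.update_add code _).update_add point _).update_add marks _).update_add
    roundCount _).update_add coordCount _).mono ?_
  simp only [encodeSet, List.length_reverse, List.length_ofFn, List.length_replicate]
  lia

theorem exec_rounds : ∃ T : Polynomial ℕ, ∀ (n : ℕ) (C : Circuit n) (x : Fin n → Bool) (m : ℕ),
    C.encode.length + 4 * n ≤ m → ∃ t ≤ n * (T.eval m + 1) + 1,
      Exec oracle rounds (roundStore C x ∅ n) (roundStore C x (certSet C.eval x n) 0) t := by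
  obtain ⟨T, G, hT⟩ := (tame_pop (O := oracle) roundCount).polyTime.seq
    ((polyTime_round true).seq (polyTime_round false))
  refine ⟨T, fun n C x m hm => Exec.iterate (fun k U => roundStore C x U k)
    (nextSet C.eval x false ∘ nextSet C.eval x true) (by simp [roundStore]) n
      (fun k hk U => ?_) ∅⟩
  obtain ⟨-, t, ht, hexec⟩ := hT (roundStore C x U (k + 1)) m
    ((sizeLE_roundStore C x U (k + 1)).mono (by lia))
  have hpop : den oracle (.pop roundCount) (roundStore C x U (k + 1)) = roundStore C x U k := by
    simp [den, roundStore, update_comm_of_lt, List.replicate_succ]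
  rw [den, hpop, den, den_round, den_round] at hexec
  exact ⟨t, ht, hexec⟩

theorem exec_certify : ∃ p : Polynomial ℕ, ∀ (n : ℕ) (C : Circuit n) (x : Fin n → Bool),
    ∃ t ≤ p.eval (n + C.size), ∃ σ, σ 0 = encodeSet (certSet C.eval x n) ∧
      Exec oracle certify (inputStore C.encode (List.ofFn x)) σ t := by
  obtain ⟨T₁, G₁, hprepare⟩ := polyTime_prepare (O := oracle)
  obtain ⟨T₂, hrounds⟩ := exec_rounds
  obtain ⟨T₃, G₃, houtput⟩ := (tame_outputMarks (O := oracle)).polyTime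
  let E : Polynomial ℕ := .X * (2 * .X + 5) + 2 * .X + 3 + 4 * .X
  refine ⟨T₁.comp E + (.X * (T₂.comp E + 1) + 1) + T₃.comp E + 2, fun n C x => ?_⟩
  have hE : C.encode.length + 4 * n ≤ E.eval (n + C.size) := by
    have := length_encode_le C
    simp only [E, Polynomial.eval_add, Polynomial.eval_mul, Polynomial.eval_X,
      Polynomial.eval_ofNat]
    lia
  obtain ⟨-, t₁, ht₁, hexec₁⟩ := hprepare (inputStore C.encode (List.ofFn x)) _
    ((sizeLE_inputStore _ _).mono (by rw [List.length_ofFn]; lia : _ ≤ E.eval (n + C.size)))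
  obtain ⟨t₂, ht₂, hexec₂⟩ := hrounds n C x _ hE
  obtain ⟨-, t₃, ht₃, hexec₃⟩ := houtput (roundStore C x (certSet C.eval x n) 0) _
    ((sizeLE_roundStore C x _ 0).mono (by lia : _ ≤ E.eval (n + C.size)))
  rw [den_prepare] at hexec₁
  refine ⟨_, ?_, _, den_outputMarks C x _, hexec₁.seq (hexec₂.seq hexec₃)⟩
  have hmul : n * (T₂.eval (E.eval (n + C.size)) + 1) ≤
      (n + C.size) * (T₂.eval (E.eval (n + C.size)) + 1) :=
    Nat.mul_le_mul_right _ (Nat.le_add_right n _)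
  simp only [Polynomial.eval_add, Polynomial.eval_mul, Polynomial.eval_comp, Polynomial.eval_X,
    Polynomial.eval_one, Polynomial.eval_ofNat]
  linarith [hmul]

theorem outputProb_eq_one {u v : List Bool} {T : ℕ} {A : Set (List Bool)}
    (h : ∀ coins : List Bool, coins.length = T → (run O P (inputStore u v) coins).todo = [] ∧
      (run O P (inputStore u v) coins).store 0 ∈ A) : outputProb O P u v T A = 1 := by
  rw [outputProb, Nat.card_congr (Equiv.subtypeUnivEquiv fun r => h _ List.length_ofFn)]
  simp

end Certification

open Certification in
theorem theorem1_general :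
    ∃ L : Language Bool, InNP L ∧ ∃ (P : Prog) (p : Polynomial ℕ),
      ∀ (n : ℕ) (C : Circuit n) (x : Fin n → Bool),
        ∃ S : Finset (Fin n), IsCertificate C.eval x S ∧ S.card ≤ certComplexity C.eval ^ 2 ∧
          ∀ coins : List Bool, coins.length = p.eval (n + C.size) →
            (run L P (inputStore C.encode (List.ofFn x)) coins).todo = [] ∧
            (run L P (inputStore C.encode (List.ofFn x)) coins).store 0 = encodeSet S := by
  obtain ⟨p, hp⟩ := exec_certify
  refine ⟨oracle, inNP_oracle, certify, p, fun n C x => ⟨certSet C.eval x n,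
    isCertificate_certSet C.eval x, card_certSet_le C.eval x n, fun coins hcoins => ?_⟩⟩
  obtain ⟨t, ht, σ, hσ, hexec⟩ := hp n C x
  rw [hexec.run_eq (hcoins ▸ ht)]
  exact ⟨rfl, hσ⟩

theorem theorem1 :
    ∃ L : Language Bool, InNP L ∧
      ∃ (P : Prog) (p : Polynomial ℕ) (K : ℕ) (ε : ℕ → ℝ),
        Asymptotics.SuperpolynomialDecay Filter.atTop (fun n : ℕ => (n : ℝ)) ε ∧
        ∀ (n : ℕ) (C : Circuit n) (x : Fin n → Bool),
          HaltsWithin L P C.encode (List.ofFn x) (p.eval (n + C.size)) ∧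
          1 - ε n ≤ outputProb L P C.encode (List.ofFn x) (p.eval (n + C.size))
            {w | ∃ S : Finset (Fin n), w = encodeSet S ∧ IsCertificate C.eval x S ∧
              S.card ≤ K * certComplexity C.eval ^ 5} := by
  obtain ⟨L, hL, P, p, hp⟩ := theorem1_general
  refine ⟨L, hL, P, p, 1, 0, Asymptotics.superpolynomialDecay_zero _ _, fun n C x => ?_⟩
  obtain ⟨S, hS, hcard, hrun⟩ := hp n C x
  have hcard' : S.card ≤ 1 * certComplexity C.eval ^ 5 := by
    rcases Nat.eq_zero_or_pos (certComplexity C.eval) with h | h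
    · simpa [h] using hcard
    · exact hcard.trans (by simpa using Nat.pow_le_pow_right h (by decide : 2 ≤ 5))
  refine ⟨fun coins hcoins => (hrun coins hcoins).1, ?_⟩
  rw [Certification.outputProb_eq_one]
  · simp
  · exact fun coins hcoins =>
      ⟨(hrun coins hcoins).1, S, (hrun coins hcoins).2, hS, hcard'⟩
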